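/- All digraphs are reflexive and have vertex set $\{0,\dots,k\}$ or $\{0,\dots,n-1\}$ as follows. A *path of length $k$* ($k\ge 0$) is a digraph on $\{0,1,\dots,k\}$ in which, for each $0\le i<k$, at least one of the arcs $(i,i+1)$, $(i+1,i)$ is present, and which has no other arcs besides the loops. For $n\ge 3$, an *$n$-cycle* is a digraph on $\{0,\dots,n-1\}$ in which, for each $i$ (indices modulo $n$), at least one of the arcs $(i,i+1)$, $(i+1,i)$ is present, and which has no other arcs besides the loops. An $n$-cycle $\mathbb G$ *satisfies the path condition* if there are no paths $\mathbb Q_1,\dots,\mathbb Q_m$ ($m\ge 1$) of length $n-2$, each isomorphic to an induced subdigraph of $\mathbb G$, that admit a surjective homomorphism $\prod_{i=1}^m\mathbb Q_i\to\mathbb G$ (arcs of the product are taken coordinatewise; homomorphisms preserve arcs); otherwise it *fails* the path condition. A cycle is *almost symmetric* if it has exactly one non-symmetric edge, i.e. exactly one arc $(x,y)$ such that $(y,x)$ is not an arc. The word $w(\mathbb S)$ of a path $\mathbb S$ of length $s$ is the word $x_1\cdots x_s$ over $\{+,-,*\}$ with $x_i=*$ if both $(i-1,i)$ and $(i,i-1)$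 are arcs, $x_i=+$ if only $(i-1,i)$ is, and $x_i=-$ if only $(i,i-1)$ is. The path $\mathbb S$ is *self-dual* if $w(\mathbb S)$ is unchanged when it is reversed and $+$ and $-$ are exchanged. Conversely, a word $x_1\cdots x_n$ with $n\ge3$ defines an $n$-cycle $C(x_1\cdots x_n)$ in which $x_i$ describes in the same way the arcs between $i-1$ and $i$ modulo $n$. **Theorem.** Let $\mathbb G$ be an $n$-cycle with $n\ge 4$. Then $\mathbb G$ fails the path condition if and only if $\mathbb G$ is almost symmetric or there exist a self-dual path $\mathbb S$ (possibly of length $0$) and an integer $k\ge 1$ such that $\mathbb G$ is isomorphic to $C\big((w(\mathbb S)\,{*}{*})^k\,w(\mathbb S)\,{+}\big)$. The "if" direction also holds for $n=3$. -/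

import Mathlib

namespace CycleWords

/-- The product of a family of digraphs: arcs are taken coordinatewise. -/
def prodDigraph {ι : Type*} {V : ι → Type*} (Q : ∀ i, Digraph (V i)) : Digraph (∀ i, V i) where
  Adj x y := ∀ i, (Q i).Adj (x i) (y i)

/-- A reflexive path of length `k`: between consecutive vertices at least one of the two
possible arcs is present, and apart from the loops there are no other arcs. -/
structure IsPath {k : ℕ} (P : Digraph (Fin (k + 1))) : Prop where
  refl : ∀ i, P.Adj i i
  consec : ∀ i : Fin k, P.Adj i.castSucc i.succ ∨ P.Adj i.succ i.castSucc
  noOther : ∀ i j, P.Adj i j → i = j ∨ i.val + 1 = j.val ∨ j.val + 1 = i.val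

/-- `j` is the vertex that follows `i` in the cyclic order `0, 1, …, n - 1, 0`. -/
def CyclicSucc {n : ℕ} (i j : Fin n) : Prop := j.val = (i.val + 1) % n

/-- A reflexive `n`-cycle (used for `3 ≤ n`): between cyclically consecutive vertices at least
one of the two possible arcs is present, and apart from the loops there are no other arcs. -/
structure IsCycle {n : ℕ} (G : Digraph (Fin n)) : Prop where
  refl : ∀ i, G.Adj i i
  consec : ∀ i j, CyclicSucc i j → G.Adj i j ∨ G.Adj j i
  noOther : ∀ i j, G.Adj i j → i = j ∨ CyclicSucc i j ∨ CyclicSucc j i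

/-- `H` is isomorphic to an induced subdigraph of `G`. -/
def Embeds {V W : Type*} (H : Digraph V) (G : Digraph W) : Prop :=
  Nonempty (H.Adj ↪r G.Adj)

/-- The two digraphs are isomorphic. -/
def Isomorphic {V W : Type*} (H : Digraph V) (G : Digraph W) : Prop :=
  Nonempty (H.Adj ≃r G.Adj)

/-- The path condition for a digraph `G` with `n` vertices: there is no surjective homomorphism
onto `G` from a product of (finitely many) paths of length `n - 2` that embed in `G`. -/
def PathCondition {n : ℕ} (G : Digraph (Fin n)) : Prop :=
  ¬ ∃ (m : ℕ) (Q : Fin m → Digraph (Fin (n - 2 + 1))),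
      0 < m ∧ (∀ i, IsPath (Q i) ∧ Embeds (Q i) G) ∧
      ∃ f : (prodDigraph Q).Adj →r G.Adj, Function.Surjective f

/-- Exactly one edge is not symmetric, that is, exactly one arc has no reverse arc. -/
def AlmostSymmetric {n : ℕ} (G : Digraph (Fin n)) : Prop :=
  ∃! e : Fin n × Fin n, G.Adj e.1 e.2 ∧ ¬ G.Adj e.2 e.1

/-- The alphabet `{+, -, *}`: forward arc, backward arc, symmetric edge. -/
inductive Letter : Type
  | plus : Letter
  | minus : Letter
  | star : Letter

/-- The involution of the alphabet that exchanges `+` and `-`. -/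
def Letter.bar : Letter → Letter
  | .plus => .minus
  | .minus => .plus
  | .star => .star

/-- The letter allows the forward direction. -/
def Letter.Fwd : Letter → Prop
  | .plus => True
  | .minus => False
  | .star => True

/-- The letter allows the backward direction. -/
def Letter.Bwd : Letter → Prop
  | .plus => False
  | .minus => True
  | .star => True

/-- The involution of words: reverse the word and exchange `+` and `-`. -/
def barWord (W : List Letter) : List Letter := (W.map Letter.bar).reverse

/-- `W` repeated `k` times. -/
def powWord (W : List Letter) (k : ℕ) : List Letter := (List.replicate k W).flatten

open Classical in
/-- The word of a path: its letter number `i` (from `0`) describes the arcs between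
the vertices `i` and `i + 1`. -/
noncomputable def pathWord {k : ℕ} (P : Digraph (Fin (k + 1))) : List Letter :=
  List.ofFn fun i : Fin k =>
    if P.Adj i.castSucc i.succ then
      if P.Adj i.succ i.castSucc then Letter.star else Letter.plus
    else Letter.minus

/-- A path is self-dual if its word is fixed by the involution. -/
def SelfDual {k : ℕ} (P : Digraph (Fin (k + 1))) : Prop := pathWord P = barWord (pathWord P)

/-- The reflexive cycle `C(W)` of a word `W`: its letter number `i` (from `0`) describes the arcs
between the vertex `i` and the vertex that follows it cyclically. -/
def cycleOfWord (W : List Letter) : Digraph (Fin W.length) where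
  Adj i j := i = j ∨ (CyclicSucc i j ∧ (W.get i).Fwd) ∨ (CyclicSucc j i ∧ (W.get j).Bwd)

/-- The word `(S**)^k S+` of a path `S`. -/
noncomputable def starWord {s : ℕ} (S : Digraph (Fin (s + 1))) (k : ℕ) : List Letter :=
  powWord (pathWord S ++ [Letter.star, Letter.star]) k ++ pathWord S ++ [Letter.plus]

/-- `G` is almost symmetric, or (up to isomorphism, that is, up to the choice of a starting point
and a direction) `G = (S**)^k S+` for a self-dual path `S` and a positive integer `k`. -/
def HasSpecialForm {n : ℕ} (G : Digraph (Fin n)) : Prop :=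
  AlmostSymmetric G ∨
    ∃ (s : ℕ) (S : Digraph (Fin (s + 1))) (k : ℕ),
      IsPath S ∧ SelfDual S ∧ 1 ≤ k ∧ Isomorphic G (cycleOfWord (starWord S k))

end CycleWords

namespace CycleWords

/-! ### Words and patterns -/

/-! The cycle is unrolled to a two-way infinite path with periodic letters, so that paths embedded
in it become factors of the cyclic word or of its reversal `barWord`.

Special form implies failure. If the cyclic word is S**Ty, the product of the paths with words S+T
and S-T folds onto the path S**T (`near_fold`), which runs through all vertices of the cycle. So it
suffices that both words are factors, up to reversal (`Wound.not_pathCondition`). For (U**)^k U+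
with U self-dual, contracting the first ** gives two such words, one for each reading direction.

Failure implies special form. For n ≥ 4 the cycle has no triangles, so a homomorphism from a product
of paths lifts to the unrolled cycle (`Wound.liftable_pi`), and by surjectivity the lift takes two
values at distance at least n - 1. Let p be a pattern of directions that contains, as subsequences
of matching directions, all factors of length n - 2 in both readings. Every path of the product then
has a p-walk between any two of its vertices, hence so has the product, and the image of such a walk
crosses a fixed factor R of length n - 1. So p contains R (`Wound.exists_contains_factor`).

The rest concerns words (`word_form_of_contains`). For every choice of a direction for each
symmetric letter of R there is a pattern `pat` that just fails to contain R; hence some factor q of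
length n - 2, in one of the readings, is not contained in it either. Counting non-symmetric letters
shows that q has one more of them than R. Moreover, q either is R with some ** contracted to one
letter z, or it skips two adjacent symmetric positions of equal direction
(`eq_or_double_loss_of_not_fits`). Directions that alternate along runs and block the possible
contractions exclude both, unless one occurrence of ** can be contracted to + as well as to -. In
that case, R = S**T, and comparing heights and areas of rotations gives S**T = T**S; commuting words
are powers of a common word, which yields the self-dual root U (`exists_root_of_isRotated`). -/

/-- The letter allows a step in the given direction (`true` is forward). -/
def Letter.allows : Letter → Bool → Bool
  | .plus, c => c
  | .minus, c => !c
  | .star, _ => true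

/-- The non-symmetric letter with the given direction. -/
def Letter.ofBool : Bool → Letter
  | true => .plus
  | false => .minus

/-- The direction of a non-symmetric letter. -/
def Letter.dir? : Letter → Option Bool
  | .plus => some true
  | .minus => some false
  | .star => none

/-- The directions of the non-symmetric letters of a word, in order. -/
def dirs (W : List Letter) : List Bool := W.filterMap Letter.dir?

/-- The word of `m` symmetric letters. -/
abbrev stars (m : ℕ) : List Letter := List.replicate m Letter.star

/-- The pattern `p` has a subsequence that is an instance of the word `W`. -/
def Contains (W : List Letter) (p : List Bool) : Prop :=
  ∃ s : List Bool, s.Sublist p ∧ List.Forall₂ (fun (l : Letter) c => l.allows c = true) W s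

theorem Letter.eq_star_or_ofBool (l : Letter) : l = .star ∨ ∃ b, l = .ofBool b := by
  cases l
  · exact Or.inr ⟨true, rfl⟩
  · exact Or.inr ⟨false, rfl⟩
  · exact Or.inl rfl

@[simp] theorem Letter.ofBool_ne_star (b : Bool) : Letter.ofBool b ≠ .star := by
  cases b <;> simp [Letter.ofBool]

@[simp] theorem Letter.star_ne_ofBool (b : Bool) : Letter.star ≠ .ofBool b := by
  cases b <;> simp [Letter.ofBool]

@[simp] theorem Letter.ofBool_inj {b c : Bool} : Letter.ofBool b = .ofBool c ↔ b = c := by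
  cases b <;> cases c <;> simp [Letter.ofBool]

@[simp] theorem Letter.allows_star (c : Bool) : Letter.star.allows c = true := rfl

@[simp] theorem Letter.allows_ofBool {b c : Bool} : (Letter.ofBool b).allows c = true ↔ b = c := by
  cases b <;> cases c <;> simp [Letter.ofBool, Letter.allows]

@[simp] theorem Letter.allows_ofBool_eq_false {b c : Bool} :
    (Letter.ofBool b).allows c = false ↔ ¬ b = c := by
  cases b <;> cases c <;> simp [Letter.ofBool, Letter.allows]

@[simp] theorem Letter.bar_bar (l : Letter) : l.bar.bar = l := by cases l <;> rfl

@[simp] theorem Letter.bar_star : Letter.star.bar = .star := rfl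

@[simp] theorem Letter.bar_ofBool (b : Bool) : (Letter.ofBool b).bar = .ofBool (!b) := by cases b <;> rfl

theorem Letter.allows_bar (l : Letter) (c : Bool) : l.bar.allows c = l.allows (!c) := by
  cases l <;> cases c <;> rfl

@[simp] theorem dirs_nil : dirs [] = [] := rfl

@[simp] theorem dirs_star_cons (W : List Letter) : dirs (.star :: W) = dirs W := rfl

@[simp] theorem dirs_ofBool_cons (b : Bool) (W : List Letter) :
    dirs (.ofBool b :: W) = b :: dirs W := by
  cases b <;> rfl

@[simp] theorem dirs_append (V W : List Letter) : dirs (V ++ W) = dirs V ++ dirs W :=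
  List.filterMap_append

@[simp] theorem dirs_stars (m : ℕ) : dirs (stars m) = [] := by
  induction m with
  | zero => rfl
  | succ m ih => simpa [stars, List.replicate_succ] using ih

theorem eq_stars_of_dirs_eq_nil : ∀ {W : List Letter}, dirs W = [] → W = stars W.length
  | [], _ => rfl
  | l :: W, h => by
    rcases l.eq_star_or_ofBool with rfl | ⟨b, rfl⟩
    · rw [dirs_star_cons] at h
      have := eq_stars_of_dirs_eq_nil h
      rw [List.length_cons, stars, List.replicate_succ, ← stars, ← this]
    · simp at h

@[simp] theorem barWord_append (V W : List Letter) : barWord (V ++ W) = barWord W ++ barWord V := by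
  simp [barWord]

@[simp] theorem barWord_nil : barWord [] = [] := rfl

@[simp] theorem barWord_barWord (W : List Letter) : barWord (barWord W) = W := by
  have : Letter.bar ∘ Letter.bar = id := by funext l; simp
  simp [barWord, List.map_reverse, this]

@[simp] theorem length_barWord (W : List Letter) : (barWord W).length = W.length := by
  simp [barWord]

theorem barWord_singleton (l : Letter) : barWord [l] = [l.bar] := rfl

theorem barWord_cons (l : Letter) (W : List Letter) : barWord (l :: W) = barWord W ++ [l.bar] := by
  simp [barWord]

theorem dirs_barWord (W : List Letter) : dirs (barWord W) = ((dirs W).map (!·)).reverse := by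
  induction W with
  | nil => rfl
  | cons l W ih =>
    rcases l.eq_star_or_ofBool with rfl | ⟨b, rfl⟩
    · simp [barWord_cons, ih]
    · simp [barWord_cons, ih]

theorem Contains.mono {W : List Letter} {p p' : List Bool} (h : Contains W p) (hp : p.Sublist p') :
    Contains W p' :=
  let ⟨s, hs, hW⟩ := h
  ⟨s, hs.trans hp, hW⟩

theorem Contains.nil (p : List Bool) : Contains [] p := ⟨[], List.nil_sublist p, .nil⟩

theorem Contains.append {V W : List Letter} {p r : List Bool} (hV : Contains V p)
    (hW : Contains W r) : Contains (V ++ W) (p ++ r) :=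
  let ⟨s, hs, hV⟩ := hV
  let ⟨t, ht, hW⟩ := hW
  ⟨s ++ t, hs.append ht, List.rel_append hV hW⟩

theorem Contains.cons {l : Letter} {W : List Letter} {c : Bool} {p : List Bool}
    (hl : l.allows c = true) (hW : Contains W p) : Contains (l :: W) (c :: p) :=
  let ⟨t, ht, hW⟩ := hW
  ⟨c :: t, ht.cons_cons c, .cons hl hW⟩

theorem Contains.infix {U V W : List Letter} {p : List Bool} (h : Contains (U ++ V ++ W) p) :
    Contains V p := by
  obtain ⟨s, hs, h⟩ := h
  rw [List.forall₂_iff_get] at h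
  obtain ⟨hlen, hget⟩ := h
  refine ⟨(s.drop U.length).take V.length,
    ((List.take_sublist _ _).trans (List.drop_sublist _ _)).trans hs, ?_⟩
  rw [List.forall₂_iff_get]
  simp only [List.length_append] at hlen
  refine ⟨by simp; omega, fun i h₁ h₂ => ?_⟩
  have := hget (U.length + i) (by simp; omega) (by omega)
  simpa [List.getElem_append, h₁, List.getElem_take, List.getElem_drop] using this

theorem Contains.of_cons_cons {l : Letter} {W : List Letter} {c : Bool} {p : List Bool}
    (h : Contains (l :: W) (c :: p)) : Contains W p := by
  obtain ⟨s, hs, hW⟩ := h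
  cases hW with
  | cons _ hW => exact ⟨_, (List.cons_sublist_cons'.1 hs).elim
      (fun h => (List.sublist_cons_self _ _).trans h) And.right, hW⟩

theorem Contains.of_cons_not_allows {l : Letter} {W : List Letter} {c : Bool} {p : List Bool}
    (h : Contains (l :: W) (c :: p)) (hl : l.allows c = false) : Contains (l :: W) p := by
  obtain ⟨s, hs, hW⟩ := h
  cases hW with
  | cons h1 hW =>
    refine ⟨_, (List.cons_sublist_cons'.1 hs).elim id fun h => ?_, .cons h1 hW⟩
    rw [h.1, hl] at h1
    cases h1

/-! ### Avoiding a word as long as possible -/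

/-- A letter of a word together with, for a symmetric letter, a chosen direction. -/
inductive Block : Type
  | star (c : Bool) : Block
  | dir (b : Bool) : Block

/-- The underlying letter. -/
def Block.letter : Block → Letter
  | .star _ => .star
  | .dir b => .ofBool b

/-- The underlying word. -/
def letters (L : List Block) : List Letter := L.map Block.letter

@[simp] theorem letters_nil : letters [] = [] := rfl
@[simp] theorem letters_star_cons (c : Bool) (L : List Block) :
    letters (.star c :: L) = .star :: letters L := rfl
@[simp] theorem letters_dir_cons (b : Bool) (L : List Block) :
    letters (.dir b :: L) = .ofBool b :: letters L := rfl
@[simp] theorem letters_append (L M : List Block) : letters (L ++ M) = letters L ++ letters M := by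
  simp [letters]
@[simp] theorem length_letters (L : List Block) : (letters L).length = L.length := by
  simp [letters]

/-- A pattern that does not contain the word `letters L`: before a non-symmetric letter is matched,
the opposite direction is repeated `N` times; a symmetric letter is matched by the chosen
direction; the last letter is not matched. -/
def pat (N : ℕ) : List Block → List Bool
  | [] => []
  | .star c :: L => if L.isEmpty then [] else c :: pat N L
  | .dir b :: L => List.replicate N (!b) ++ if L.isEmpty then [] else b :: pat N L

/-- The greedy matching of a word into `pat N L` succeeds (for large `N`). -/
def Fits : List Block → List Letter → Prop
  | [], _ => False
  | .star _ :: _, [] => True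
  | .star c :: L, l :: q => (l.allows c = true ∧ Fits L q) ∨ (l.allows c = false ∧ Fits L (l :: q))
  | .dir b :: L, q => (∀ l ∈ q, l.allows (!b) = true) ∨
      ∃ s q', q = s ++ .ofBool b :: q' ∧ (∀ l ∈ s, l.allows (!b) = true) ∧ Fits L q'

theorem not_contains_replicate {N : ℕ} {b : Bool} {W : List Letter} {p : List Bool}
    (h : Contains (.ofBool b :: W) (List.replicate N (!b) ++ p)) : Contains (.ofBool b :: W) p := by
  induction N with
  | zero => simpa using h
  | succ N ih =>
    rw [List.replicate_succ, List.cons_append] at h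
    exact ih (h.of_cons_not_allows (by cases b <;> rfl))

/-- Greedy matching is optimal: the run of `!b` is useless for the letter `b`, so each block
advances the match by at most one letter, and the entry for the last block is missing. -/
theorem not_contains_pat (N : ℕ) : ∀ L : List Block, L ≠ [] → ¬ Contains (letters L) (pat N L)
  | [], h => absurd rfl h
  | .star c :: L, _ => fun h => by
    by_cases hL : L = []
    · subst hL
      obtain ⟨s, hs, hW⟩ := h
      simp [pat] at hs
      subst hs
      cases hW
    · simp only [letters_star_cons, pat, List.isEmpty_iff, hL, if_false] at h
      exact not_contains_pat N L hL h.of_cons_cons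
  | .dir b :: L, _ => fun h => by
    simp only [letters_dir_cons, pat, List.isEmpty_iff] at h
    have h := not_contains_replicate h
    by_cases hL : L = []
    · subst hL
      obtain ⟨s, hs, hW⟩ := h
      simp at hs
      subst hs
      cases hW
    · simp only [hL, if_false] at h
      exact not_contains_pat N L hL h.of_cons_cons

theorem contains_replicate {N : ℕ} {c : Bool} : ∀ {q : List Letter}, q.length ≤ N →
    (∀ l ∈ q, l.allows c = true) → Contains q (List.replicate N c) := by
  intro q hq h
  refine ⟨List.replicate q.length c, by simpa using hq, ?_⟩
  rw [List.forall₂_iff_get]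
  exact ⟨by simp, fun i h₁ h₂ => by simpa using h _ (List.getElem_mem h₁)⟩

/-- The bound on the length of `q` ensures that a run of `N` equal directions can swallow as many
letters as needed. -/
theorem Fits.contains {N : ℕ} : ∀ {L : List Block} {q : List Letter}, q.length ≤ N → Fits L q →
    Contains q (pat N L)
  | [], _, _, h => h.elim
  | .star _ :: _, [], _, _ => Contains.nil _
  | .star c :: L, l :: q, hq, h => by
    have hL : L ≠ [] := by
      rintro rfl
      rcases h with h | h <;> exact h.2
    simp only [pat, List.isEmpty_iff, hL, if_false]
    rcases h with h | h
    · exact (Fits.contains (by simp at hq; omega) h.2).cons h.1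
    · exact (Fits.contains hq h.2).mono (List.sublist_cons_self _ _)
  | .dir b :: L, q, hq, h => by
    rcases h with h | ⟨s, q', rfl, hs, h⟩
    · exact (contains_replicate hq h).mono (List.sublist_append_left _ _)
    · have hL : L ≠ [] := by
        rintro rfl
        exact h
      simp only [pat, List.isEmpty_iff, hL, if_false]
      simp at hq
      exact (contains_replicate (by omega) hs).append
        ((Fits.contains (by omega) h).cons (by simp))

theorem exists_of_not_fits_dir {b : Bool} {L : List Block} {q : List Letter}
    (h : ¬ Fits (.dir b :: L) q) : ∃ s q', q = s ++ .ofBool b :: q' ∧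
      (∀ l ∈ s, l.allows (!b) = true) ∧ ¬ Fits L q' := by
  have key : ∀ q : List Letter, (∀ l ∈ q, l.allows (!b) = true) ∨ ∃ s q', q = s ++ .ofBool b :: q' ∧
      (∀ l ∈ s, l.allows (!b) = true) := by
    intro q
    induction q with
    | nil => left; simp
    | cons l q ih =>
      by_cases hl : l.allows (!b) = true
      · rcases ih with ih | ⟨s, q', rfl, hs⟩
        · left; simpa [hl] using ih
        · exact Or.inr ⟨l :: s, q', rfl, by simpa [hl] using hs⟩
      · refine Or.inr ⟨[], q, ?_, by simp⟩
        rcases l.eq_star_or_ofBool with rfl | ⟨c, rfl⟩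
        · simp at hl
        · simp at hl
          subst hl
          rfl
  simp only [Fits, not_or, not_exists, not_and] at h
  obtain ⟨s, q', rfl, hs⟩ := (key q).resolve_left h.1
  exact ⟨s, q', rfl, hs, h.2 s q' rfl hs⟩

/-! ### Words that do not fit -/

/-- A symmetric block followed by a non-symmetric one has the direction of the latter. -/
def Coherent (L : List Block) : Prop :=
  L.IsChain fun B B' => ∀ c b, B = .star c → B' = .dir b → c = b

theorem Coherent.tail {B : Block} {L : List Block} (h : Coherent (B :: L)) : Coherent L :=
  List.IsChain.tail h

theorem Coherent.eq {c b : Bool} {L : List Block} (h : Coherent (.star c :: .dir b :: L)) :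
    c = b :=
  (List.isChain_cons_cons.1 h).1 c b rfl rfl

/-- The word arises from `letters L` by inserting symmetric letters before non-symmetric letters
and at the end. -/
inductive Dominates : List Block → List Letter → Prop
  | nil (m : ℕ) : Dominates [] (stars m)
  | star (c : Bool) {L : List Block} {q : List Letter} (h : Dominates L q) :
      Dominates (.star c :: L) (.star :: q)
  | dir (b : Bool) (m : ℕ) {L : List Block} {q : List Letter} (h : Dominates L q) :
      Dominates (.dir b :: L) (stars m ++ .ofBool b :: q)

/-- The word arises from `letters L` by inserting symmetric letters before non-symmetric letters. -/
inductive DominatesExact : List Block → List Letter → Prop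
  | nil : DominatesExact [] []
  | star (c : Bool) {L : List Block} {q : List Letter} (h : DominatesExact L q) :
      DominatesExact (.star c :: L) (.star :: q)
  | dir (b : Bool) (m : ℕ) {L : List Block} {q : List Letter} (h : DominatesExact L q) :
      DominatesExact (.dir b :: L) (stars m ++ .ofBool b :: q)

/-- The number of symmetric letters at the end of a word. -/
def trail : List Letter → ℕ
  | [] => 0
  | l :: q => if (dirs (l :: q)).isEmpty then q.length + 1 else trail q

theorem trail_star_cons (W : List Letter) :
    trail (.star :: W) = if (dirs W).isEmpty then W.length + 1 else trail W := rfl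

theorem trail_of_dirs_eq_nil : ∀ {q : List Letter}, dirs q = [] → trail q = q.length
  | [], _ => rfl
  | l :: q, h => by simp [trail, h]

theorem trail_append_of_ne {V W : List Letter} (h : dirs W ≠ []) : trail (V ++ W) = trail W := by
  induction V with
  | nil => rfl
  | cons l V ih =>
    have : dirs (l :: (V ++ W)) ≠ [] := by
      rcases l.eq_star_or_ofBool with rfl | ⟨b, rfl⟩ <;> simp [h]
    rw [List.cons_append, trail, if_neg (by simpa using this), ih]

theorem trail_ofBool_cons (b : Bool) (W : List Letter) : trail (.ofBool b :: W) = trail W := by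
  simp [trail]

theorem trail_append_stars (W : List Letter) (d : ℕ) : trail (W ++ stars d) = trail W + d := by
  induction W with
  | nil => simpa [trail] using trail_of_dirs_eq_nil (dirs_stars d)
  | cons l W ih =>
    have : dirs (l :: (W ++ stars d)) = dirs (l :: W) := by
      rw [← List.cons_append, dirs_append]; simp
    rw [List.cons_append, trail, trail, this, ih]
    split_ifs
    · simp; omega
    · rfl

theorem Dominates.dirs_eq {L : List Block} {q : List Letter} (h : Dominates L q) :
    dirs q = dirs (letters L) := by
  induction h with
  | nil m => simp
  | star c _ ih => simpa using ih
  | dir b m _ ih => simpa using ih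

theorem Dominates.length_le {L : List Block} {q : List Letter} (h : Dominates L q) :
    L.length ≤ q.length := by
  induction h with
  | nil m => simp
  | star c _ ih => simpa using ih
  | dir b m _ ih => simp; omega

theorem Dominates.eq_of_length_le {L : List Block} {q : List Letter} (h : Dominates L q)
    (hq : q.length ≤ L.length) : q = letters L := by
  induction h with
  | nil m => simp at hq; simp [hq]
  | star c _ ih => simpa using ih (by simpa using hq)
  | dir b m h ih =>
    have := h.length_le
    simp at hq
    obtain rfl : m = 0 := by omega
    simpa using ih (by omega)

theorem Dominates.trail_le {L : List Block} {q : List Letter} (h : Dominates L q) :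
    trail (letters L) ≤ trail q := by
  induction h with
  | nil m => simp [trail]
  | @star c L q h ih =>
    have := h.dirs_eq
    have hl := h.length_le
    rw [letters_star_cons, trail_star_cons, trail_star_cons, this]
    split_ifs
    · simpa using hl
    · exact ih
  | @dir b m L q h ih =>
    rw [trail_append_of_ne (by simp), trail_ofBool_cons, letters_dir_cons, trail_ofBool_cons]
    exact ih

theorem DominatesExact.dirs_eq {L : List Block} {q : List Letter} (h : DominatesExact L q) :
    dirs q = dirs (letters L) := by
  induction h with
  | nil => simp
  | star c _ ih => simpa using ih
  | dir b m _ ih => simpa using ih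

theorem DominatesExact.length_le {L : List Block} {q : List Letter} (h : DominatesExact L q) :
    L.length ≤ q.length := by
  induction h with
  | nil => simp
  | star c _ ih => simpa using ih
  | dir b m _ ih => simp; omega

theorem DominatesExact.eq_of_length_le {L : List Block} {q : List Letter}
    (h : DominatesExact L q) (hq : q.length ≤ L.length) : q = letters L := by
  induction h with
  | nil => rfl
  | star c _ ih => simpa using ih (by simpa using hq)
  | dir b m h ih =>
    have := h.length_le
    simp at hq
    obtain rfl : m = 0 := by omega
    simpa using ih (by omega)

theorem DominatesExact.eq_of_dirs_eq_nil {L : List Block} {q : List Letter}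
    (h : DominatesExact L q) (hL : dirs (letters L) = []) : q = letters L := by
  induction h with
  | nil => rfl
  | star c _ ih => simpa using ih (by simpa using hL)
  | dir b m h ih => simp at hL

theorem DominatesExact.trail_eq {L : List Block} {q : List Letter} (h : DominatesExact L q) :
    trail q = trail (letters L) := by
  induction h with
  | nil => rfl
  | @star c L q h ih =>
    have := h.dirs_eq
    rw [letters_star_cons, trail_star_cons, trail_star_cons, this]
    split_ifs with h0
    · rw [h.eq_of_dirs_eq_nil (by simpa using h0)]
    · exact ih
  | @dir b m L q h ih =>
    rw [trail_append_of_ne (by simp), trail_ofBool_cons, letters_dir_cons, trail_ofBool_cons]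
    exact ih

/-- Exhausting the pattern costs one non-symmetric letter per non-symmetric block, so none is to
spare and everything else in `q` is symmetric. A non-symmetric letter `b` meeting a star block
cannot be consumed there. If it is skipped, the induction hypothesis puts a block `.dir b` next, and
coherence gives the star direction `b`, so it would not have been skipped. -/
theorem dominates_of_not_fits : ∀ {L : List Block} {q : List Letter}, Coherent L →
    (dirs q).length ≤ (dirs (letters L)).length → ¬ Fits L q → Dominates L q
  | [], q, _, hq, _ => by
    rw [eq_stars_of_dirs_eq_nil (W := q) (by simpa using hq)]
    exact .nil _
  | .star c :: L, [], _, _, h => (h trivial).elim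
  | .star c :: L, l :: q, hL, hq, h => by
    simp only [Fits, not_or, not_and] at h
    rcases l.eq_star_or_ofBool with rfl | ⟨b, rfl⟩
    · exact .star c (dominates_of_not_fits hL.tail (by simpa using hq) (h.1 rfl))
    · exfalso
      by_cases hb : b = c
      · subst hb
        simp at hq
        have := (dominates_of_not_fits hL.tail (by omega) (h.1 (by simp))).dirs_eq
        rw [this] at hq
        omega
      · have hD := dominates_of_not_fits hL.tail (q := .ofBool b :: q) (by simpa using hq)
          (h.2 (by simpa using hb))
        generalize hw : Letter.ofBool b :: q = w at hD
        cases hD with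
        | nil m => cases m <;> simp [List.replicate_succ] at hw
        | star c _ => simp at hw
        | dir b' m _ =>
          cases m with
          | zero =>
            simp at hw
            exact hb (hw.1.trans hL.eq.symm)
          | succ m => simp [List.replicate_succ] at hw
  | .dir b :: L, q, hL, hq, h => by
    obtain ⟨s, q', rfl, hs, h⟩ := exists_of_not_fits_dir h
    simp at hq
    have hD := dominates_of_not_fits hL.tail (by omega) h
    rw [hD.dirs_eq] at hq
    rw [eq_stars_of_dirs_eq_nil (W := s) (List.length_eq_zero_iff.1 (by omega))]
    exact .dir b _ hD

/-- A short word with at most one additional non-symmetric letter that does not fit loses a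
symmetric block at the additional letter. -/
theorem exists_loss_of_not_fits : ∀ {L : List Block} {q : List Letter}, Coherent L →
    q.length + 1 ≤ L.length → (dirs q).length ≤ (dirs (letters L)).length + 1 → ¬ Fits L q →
    ∃ L₁ L₂ q₁ q₂ z, L = L₁ ++ .star (!z) :: L₂ ∧ q = q₁ ++ .ofBool z :: q₂ ∧
      DominatesExact L₁ q₁ ∧ ¬ Fits L₂ (.ofBool z :: q₂)
  | [], q, _, hl, _, _ => by simp at hl
  | .star c :: L, [], _, _, _, h => (h trivial).elim
  | .star c :: L, l :: q, hL, hl, hq, h => by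
    simp only [Fits, not_or, not_and] at h
    simp at hl
    rcases l.eq_star_or_ofBool with rfl | ⟨b, rfl⟩
    · obtain ⟨L₁, L₂, q₁, q₂, z, rfl, rfl, h1, h2⟩ :=
        exists_loss_of_not_fits hL.tail (by omega) (by simpa using hq) (h.1 rfl)
      exact ⟨.star c :: L₁, L₂, .star :: q₁, q₂, z, rfl, rfl, .star c h1, h2⟩
    -- Consuming the letter here would use up the only spare non-symmetric letter, so the remainder
    -- would dominate `L` and be too long.
    · by_cases hb : b = c
      · exfalso
        subst hb
        simp at hq
        have := (dominates_of_not_fits hL.tail hq (h.1 (by simp))).length_le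
        omega
      · obtain rfl : c = !b := by cases b <;> cases c <;> simp_all
        exact ⟨[], L, [], q, b, rfl, rfl, .nil, h.2 (by simp)⟩
  | .dir b :: L, q, hL, hl, hq, h => by
    obtain ⟨s, q', rfl, hs, h⟩ := exists_of_not_fits_dir h
    simp at hq hl
    by_cases hs0 : dirs s = []
    · obtain ⟨L₁, L₂, q₁, q₂, z, rfl, rfl, h1, h2⟩ :=
        exists_loss_of_not_fits hL.tail (by omega) (by omega) h
      refine ⟨.dir b :: L₁, L₂, s ++ .ofBool b :: q₁, q₂, z, rfl, by simp, ?_, h2⟩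
      rw [eq_stars_of_dirs_eq_nil hs0]
      exact .dir b _ h1
    · exfalso
      have := List.length_pos_iff.2 hs0
      have := (dominates_of_not_fits hL.tail (by omega) h).length_le
      omega

/-- The lost letter `z` is still waiting. It may skip further star blocks of direction `!z`, until a
star block of direction `z` consumes it or the run before a non-symmetric block swallows it;
coherence gives that block the direction `!z`. From there on no letter is to spare, and domination
applies. -/
theorem not_fits_after_loss {z : Bool} : ∀ {L : List Block} {q : List Letter},
    Coherent (.star (!z) :: L) → (dirs q).length ≤ (dirs (letters L)).length →
    ¬ Fits L (.ofBool z :: q) →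
    dirs q = dirs (letters L) ∧ (dirs (letters L) ≠ [] → trail (letters L) ≤ trail q)
  | [], q, _, hq, _ => by simpa using hq
  | .star c :: L, q, hL, hq, h => by
    simp only [Fits, not_or, not_and] at h
    simp only [letters_star_cons, dirs_star_cons] at hq ⊢
    have ht : dirs (letters L) ≠ [] → trail (.star :: letters L) = trail (letters L) :=
      fun h => trail_append_of_ne (V := [.star]) h
    by_cases hz : z = c
    · subst hz
      have hD := dominates_of_not_fits hL.tail.tail hq (h.1 (by simp))
      exact ⟨hD.dirs_eq, fun h0 => by rw [ht h0]; exact hD.trail_le⟩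
    · obtain rfl : c = !z := by cases z <;> cases c <;> simp_all
      have := not_fits_after_loss hL.tail hq (h.2 (by simp))
      exact ⟨this.1, fun h0 => by rw [ht h0]; exact this.2 h0⟩
  | .dir b :: L, q, hL, hq, h => by
    obtain rfl := hL.eq
    obtain ⟨s, q', hs', hs, hf⟩ := exists_of_not_fits_dir h
    cases s with
    | nil => simp at hs'
    | cons l s =>
      simp at hs'
      obtain ⟨-, rfl⟩ := hs'
      simp at hq
      have hD := dominates_of_not_fits hL.tail.tail (by omega) hf
      rw [hD.dirs_eq] at hq
      have hs0 : dirs s = [] := List.length_eq_zero_iff.1 (by omega)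
      refine ⟨by simp [hs0, hD.dirs_eq], fun _ => ?_⟩
      rw [trail_append_of_ne (by simp), trail_ofBool_cons, letters_dir_cons, trail_ofBool_cons]
      exact hD.trail_le

/-- A short word with at most one additional non-symmetric letter that does not fit either arises
from `letters L` by replacing two adjacent symmetric letters by one non-symmetric letter, or loses
two adjacent symmetric blocks of the same direction. -/
theorem eq_or_double_loss_of_not_fits {L : List Block} {q : List Letter} (hL : Coherent L)
    (hl : q.length + 1 ≤ L.length) (hq : (dirs q).length ≤ (dirs (letters L)).length + 1)
    (h : ¬ Fits L q) :
    ∃ L₁ L₂ q₁ q₂ z c, L = L₁ ++ .star (!z) :: .star c :: L₂ ∧ q = q₁ ++ .ofBool z :: q₂ ∧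
      dirs q₁ = dirs (letters L₁) ∧ dirs q₂ = dirs (letters L₂) ∧
      ((q₁ = letters L₁ ∧ q₂ = letters L₂) ∨
        (c = !z ∧ (∃ c' L₃, L₂ = .star c' :: L₃) ∧ DominatesExact L₁ q₁ ∧
          (dirs (letters L₂) ≠ [] → trail (letters L₂) ≤ trail q₂))) := by
  obtain ⟨L₁, L₂, q₁, q₂, z, rfl, rfl, h1, h2⟩ := exists_loss_of_not_fits hL hl hq h
  have hl1 := h1.length_le
  have hd1 := h1.dirs_eq
  have hL₂ : Coherent (.star (!z) :: L₂) := (List.isChain_append.1 hL).2.1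
  simp [hd1] at hl hq
  replace hq : (dirs q₂).length ≤ (dirs (letters L₂)).length := by omega
  have hN := not_fits_after_loss hL₂ hq h2
  cases L₂ with
  | nil => simp at hl; omega
  | cons B L₃ =>
    cases B with
    | dir b =>
      -- Here `z` is swallowed for free by the run before the block, so only one position is saved,
      -- which is one too few for the length of `q`.
      exfalso
      obtain rfl := hL₂.eq
      obtain ⟨s, q', hs', hs, hf⟩ := exists_of_not_fits_dir h2
      cases s with
      | nil => simp at hs'
      | cons l s =>
        simp at hs'
        obtain ⟨-, rfl⟩ := hs'
        simp at hq
        have hD := (dominates_of_not_fits hL₂.tail.tail (by omega) hf).length_le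
        simp at hl
        omega
    | star c =>
      refine ⟨L₁, L₃, q₁, q₂, z, c, rfl, rfl, hd1, by simpa using hN.1, ?_⟩
      simp only [Fits, not_or, not_and] at h2
      simp at hl hq
      -- The two lost positions balance `z` and the missing letter of `q`, so no inserted symmetric
      -- letters are possible once both parts of `q` are at least as long as their counterparts.
      have hex : L₃.length ≤ q₂.length → (L₃.length = q₂.length → q₂ = letters L₃) →
          (q₁ = letters L₁ ∧ q₂ = letters L₃) := fun hle heq =>
        ⟨h1.eq_of_length_le (by omega), heq (by omega)⟩
      by_cases hz : z = c
      · subst hz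
        have hD := dominates_of_not_fits hL₂.tail.tail hq (h2.1 (by simp))
        exact Or.inl (hex hD.length_le fun h => hD.eq_of_length_le h.ge)
      · obtain rfl : c = !z := by cases z <;> cases c <;> simp_all
        have hN' := not_fits_after_loss hL₂.tail hq (h2.2 (by simp))
        cases L₃ with
        | nil =>
          refine Or.inl (hex (by simp) fun h => ?_)
          simpa using h.symm
        | cons B L₄ =>
          cases B with
          | star c' => exact Or.inr ⟨rfl, ⟨c', L₄, rfl⟩, h1, hN'.2⟩
          | dir b =>
            left
            obtain rfl := hL₂.tail.eq
            obtain ⟨s, q', hs', hs, hf⟩ := exists_of_not_fits_dir (h2.2 (by simp))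
            cases s with
            | nil => simp at hs'
            | cons l s =>
              simp at hs'
              obtain ⟨-, rfl⟩ := hs'
              simp at hq
              have hD := dominates_of_not_fits hL₂.tail.tail.tail (by omega) hf
              have hDl := hD.length_le
              refine hex (by simp; omega) fun h => ?_
              simp at h
              have hs0 : s = [] := List.length_eq_zero_iff.1 (by omega)
              subst hs0
              simp at h
              simp [hD.eq_of_length_le h.ge]

/-! ### Rotations of words -/

theorem isRotated_iff_exists_append {α : Type*} {l l' : List α} :
    l ~r l' ↔ ∃ u v, l = u ++ v ∧ l' = v ++ u := by
  constructor
  · rintro ⟨m, rfl⟩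
    exact ⟨_, _, (List.take_append_drop (m % l.length) l).symm, List.rotate_eq_drop_append_take_mod⟩
  · rintro ⟨u, v, rfl, rfl⟩
    exact List.isRotated_append

theorem isRotated_barWord {V W : List Letter} (h : V ~r W) : barWord V ~r barWord W :=
  (h.map _).reverse

/-! ### Height and area of words -/

/-- The contribution of a letter to the height. -/
def Letter.sgn : Letter → ℤ
  | .plus => 1
  | .minus => -1
  | .star => 0

/-- The number of forward letters minus the number of backward letters. -/
def height (W : List Letter) : ℤ := (W.map Letter.sgn).sum

/-- The sum of the heights of all prefixes. -/
def area : List Letter → ℤ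
  | [] => 0
  | l :: W => l.sgn * (W.length + 1) + area W

@[simp] theorem height_nil : height [] = 0 := rfl
@[simp] theorem height_cons (l : Letter) (W : List Letter) : height (l :: W) = l.sgn + height W := by
  simp [height]
@[simp] theorem height_append (V W : List Letter) : height (V ++ W) = height V + height W := by
  simp [height]
@[simp] theorem Letter.sgn_star : Letter.star.sgn = 0 := rfl
@[simp] theorem Letter.sgn_bar (l : Letter) : l.bar.sgn = -l.sgn := by cases l <;> rfl
theorem Letter.sgn_ofBool (b : Bool) : (Letter.ofBool b).sgn = 1 ∨ (Letter.ofBool b).sgn = -1 := by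
  cases b
  · exact Or.inr rfl
  · exact Or.inl rfl
theorem Letter.sgn_ofBool_not (b : Bool) : (Letter.ofBool (!b)).sgn = -(Letter.ofBool b).sgn := by
  cases b <;> rfl

theorem height_barWord (W : List Letter) : height (barWord W) = -height W := by
  induction W with
  | nil => rfl
  | cons l W ih => simp [barWord_cons, ih, add_comm]

theorem height_map_dirs (W : List Letter) : height ((dirs W).map Letter.ofBool) = height W := by
  induction W with
  | nil => rfl
  | cons l W ih =>
    rcases l.eq_star_or_ofBool with rfl | ⟨b, rfl⟩ <;> simp [ih]

theorem height_eq_of_dirs_eq {V W : List Letter} (h : dirs V = dirs W) : height V = height W := by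
  rw [← height_map_dirs V, h, height_map_dirs]

theorem height_eq_of_isRotated {V W : List Letter} (h : V ~r W) : height V = height W :=
  (h.perm.map _).sum_eq

theorem abs_height_le (W : List Letter) : |height W| ≤ W.length := by
  induction W with
  | nil => simp
  | cons l W ih =>
    have : |l.sgn| ≤ 1 := by cases l <;> decide
    have := abs_add_le l.sgn (height W)
    simp
    omega

theorem area_append (V W : List Letter) :
    area (V ++ W) = area V + height V * W.length + area W := by
  induction V with
  | nil => simp [area]
  | cons l V ih => simp [area, ih]; ring

/-- Comparing the areas of `u ++ v` and `v ++ u` makes the heights of `u` and `v` proportional to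
their lengths. Two nonempty words would then have heights of the same sign or both zero, and the
integers could not add up to 1 or -1. -/
theorem eq_nil_of_append_comm {u v : List Letter} (h : u ++ v = v ++ u)
    (hs : height (u ++ v) = 1 ∨ height (u ++ v) = -1) : u = [] ∨ v = [] := by
  by_contra! hn
  have h1 : (1 : ℤ) ≤ u.length := by exact_mod_cast List.length_pos_iff.2 hn.1
  have h2 : (1 : ℤ) ≤ v.length := by exact_mod_cast List.length_pos_iff.2 hn.2
  have ha := congrArg area h
  rw [area_append, area_append] at ha
  rw [height_append] at hs
  generalize height u = a at *
  generalize height v = b at *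
  generalize (u.length : ℤ) = m at *
  generalize (v.length : ℤ) = k at *
  have hm : a * k = b * m := by linarith
  rcases hs with hs | hs
  · obtain rfl : a = 1 - b := by linarith
    rcases le_or_gt b 0 with hb | hb <;> nlinarith
  · obtain rfl : a = -1 - b := by linarith
    rcases le_or_gt 0 b with hb | hb <;> nlinarith

/-- The number of non-symmetric letters before the marked letter determines its position. -/
theorem append_ofBool_inj : ∀ {X X' Y Y' : List Letter} {z z' : Bool},
    X ++ .ofBool z :: Y = X' ++ .ofBool z' :: Y' → (dirs X).length = (dirs X').length →
    X = X' ∧ Y = Y'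
  | [], [], _, _, _, _, h, _ => by simpa using (List.cons.inj h).2
  | [], l :: X', _, _, _, _, h, hd => by
    simp at h hd
    rw [← h.1] at hd
    simp at hd
  | l :: X, [], _, _, _, _, h, hd => by
    simp at h hd
    rw [h.1] at hd
    simp at hd
  | l :: X, l' :: X', _, _, _, _, h, hd => by
    simp only [List.cons_append, List.cons.injEq] at h
    obtain ⟨rfl, h⟩ := h
    have := append_ofBool_inj h (by
      rcases l.eq_star_or_ofBool with rfl | ⟨b, rfl⟩ <;> simpa using hd)
    exact ⟨by rw [this.1], this.2⟩

/-- The rotation between two words of height `1` or `-1` with the same sequence of non-symmetric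
letters moves only symmetric letters. -/
theorem eq_stars_append_of_isRotated {q₁ q₂ r₁ r₂ : List Letter} {z : Bool}
    (h : q₁ ++ .ofBool z :: (q₂ ++ stars 2) ~r r₁ ++ .ofBool z :: (r₂ ++ stars 2))
    (h1 : dirs q₁ = dirs r₁) (h2 : dirs q₂ = dirs r₂)
    (hs : height (q₁ ++ .ofBool z :: q₂) = 1 ∨ height (q₁ ++ .ofBool z :: q₂) = -1) :
    ∃ k, (q₁ = stars k ++ r₁ ∧ r₂ = q₂ ++ stars k) ∨ (r₁ = stars k ++ q₁ ∧ q₂ = r₂ ++ stars k) := by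
  have aux : ∀ {q₁ q₂ r₁ r₂ v : List Letter} {k : ℕ}, dirs q₁ = dirs r₁ →
      q₁ ++ .ofBool z :: (q₂ ++ stars 2) = stars k ++ v →
      r₁ ++ .ofBool z :: (r₂ ++ stars 2) = v ++ stars k →
      q₁ = stars k ++ r₁ ∧ r₂ = q₂ ++ stars k := by
    intro q₁ q₂ r₁ r₂ v k h1 hq hr
    have hc : (stars k ++ r₁) ++ .ofBool z :: (r₂ ++ stars 2) =
        q₁ ++ .ofBool z :: (q₂ ++ stars k ++ stars 2) := by
      rw [List.append_assoc, hr, ← List.append_assoc, ← hq]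
      simp only [List.append_assoc, List.cons_append, List.replicate_append_replicate, add_comm]
    have := append_ofBool_inj hc (by simp [h1])
    exact ⟨this.1.symm, List.append_cancel_right this.2⟩
  obtain ⟨u, v, hu, hv⟩ := isRotated_iff_exists_append.1 h
  have hd : dirs u ++ dirs v = dirs v ++ dirs u := by
    rw [← dirs_append, ← dirs_append, ← hu, ← hv]
    simp [h1, h2]
  have hc := eq_nil_of_append_comm
    (u := (dirs u).map Letter.ofBool) (v := (dirs v).map Letter.ofBool)
    (by rw [← List.map_append, hd, List.map_append])
    (by
      rw [← List.map_append, ← dirs_append, height_map_dirs, ← hu]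
      simpa [stars, List.replicate_succ] using hs)
  simp only [List.map_eq_nil_iff] at hc
  rcases hc with hc | hc
  · rw [eq_stars_of_dirs_eq_nil hc] at hu hv
    exact ⟨_, Or.inl (aux h1 hu hv)⟩
  · rw [eq_stars_of_dirs_eq_nil hc] at hu hv
    exact ⟨_, Or.inr (aux h1.symm hv hu)⟩

/-! ### Self-dual roots -/

/-- A nontrivial rotation would give `D = u b v` and `barWord D = v b u`. Applying the involution to
the second equation puts the opposite letter in the place of `b` in `D`. -/
theorem eq_barWord_of_isRotated {D : List Letter} {b : Bool}
    (h : D ++ [.ofBool b] ~r barWord D ++ [.ofBool b]) : D = barWord D := by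
  obtain ⟨u, v, hu, hv⟩ := isRotated_iff_exists_append.1 h
  rcases List.eq_nil_or_concat' u with rfl | ⟨u, c, rfl⟩
  · exact List.append_cancel_right (hu.trans (by simpa using hv.symm))
  rcases List.eq_nil_or_concat' v with rfl | ⟨v, c', rfl⟩
  · exact List.append_cancel_right ((hu.trans (List.append_nil _)).trans hv.symm)
  rw [← List.append_assoc] at hu hv
  obtain ⟨h1, h1'⟩ := List.append_inj' hu rfl
  obtain ⟨h2, h2'⟩ := List.append_inj' hv rfl
  simp at h1' h2'
  subst h1' h2'
  have h3 := congrArg barWord h2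
  rw [barWord_barWord, h1] at h3
  simp only [barWord_append, barWord_singleton, List.append_assoc] at h3
  have h4 := (List.append_inj h3 (by simp)).2
  simp at h4

/-- A nontrivial rotation would give S**T = u b v and T**S = v b u. Subtracting the areas of the two
equations yields an integer relation between the heights of `S` and `u` that is incompatible with
the bounds of heights by lengths. -/
theorem append_comm_of_isRotated {S T : List Letter} {b : Bool} (hST : height S + height T = 0)
    (h : S ++ stars 2 ++ T ++ [.ofBool b] ~r T ++ stars 2 ++ S ++ [.ofBool b]) :
    S ++ stars 2 ++ T = T ++ stars 2 ++ S := by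
  obtain ⟨u, v, hu, hv⟩ := isRotated_iff_exists_append.1 h
  rcases List.eq_nil_or_concat' u with rfl | ⟨u, c, rfl⟩
  · exact List.append_cancel_right (hu.trans (by simpa using hv.symm))
  rcases List.eq_nil_or_concat' v with rfl | ⟨v, c', rfl⟩
  · exact List.append_cancel_right ((hu.trans (List.append_nil _)).trans hv.symm)
  exfalso
  rw [← List.append_assoc] at hu hv
  obtain ⟨h1, h1'⟩ := List.append_inj' hu rfl
  obtain ⟨h2, h2'⟩ := List.append_inj' hv rfl
  simp at h1' h2'
  subst h1' h2'
  have e1 := congrArg area h1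
  have e2 := congrArg area h2
  have e3 := congrArg height h1
  have e4 := congrArg List.length h1
  have hs : height (stars 2) = 0 := rfl
  have ha : area (stars 2) = 0 := rfl
  have ha' : area [Letter.ofBool b] = (Letter.ofBool b).sgn := by simp [area]
  simp only [area_append, height_append, List.length_append, hs, ha, ha', List.length_replicate,
    List.length_singleton, height_cons, height_nil, Nat.cast_ofNat,
    Nat.cast_one] at e1 e2 e3 e4
  have bu := abs_le.1 (abs_height_le u)
  have bv := abs_le.1 (abs_height_le v)
  have bS := abs_le.1 (abs_height_le S)
  have bT := abs_le.1 (abs_height_le T)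
  replace e4 : (S.length : ℤ) + 2 + T.length = u.length + 1 + v.length := by exact_mod_cast e4
  have hi : (0 : ℤ) ≤ u.length := by positivity
  have hj : (0 : ℤ) ≤ v.length := by positivity
  have hm : (0 : ℤ) ≤ S.length := by positivity
  have hn : (0 : ℤ) ≤ T.length := by positivity
  obtain ⟨bu1, bu2⟩ := bu
  obtain ⟨bv1, bv2⟩ := bv
  obtain ⟨bS1, bS2⟩ := bS
  obtain ⟨bT1, bT2⟩ := bT
  generalize height S = x at *
  generalize height T = x' at *
  generalize height u = s at *
  generalize height v = t at *
  generalize (S.length : ℤ) = m at *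
  generalize (T.length : ℤ) = n at *
  generalize (u.length : ℤ) = i at *
  generalize (v.length : ℤ) = j at *
  -- `x` and `s` are the heights of `S` and `u`, and `i`, `j`, `m` the lengths of `u`, `v`, `S`. The
  -- right side of the equation is too small in absolute value unless `x - s` is 0 or 1, and these
  -- two values violate the bounds on `s`.
  have key : ∀ x s i j m : ℤ, 0 ≤ i → 0 ≤ j → m ≤ i + j - 1 → -m ≤ x → x ≤ m → -i ≤ s → -j ≤ -s - 1 →
      (x - s) * (i + j + 2) = 1 + j - x → False := by
    intro x s i j m hi hj hm h1 h2 h3 h4 h5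
    rcases lt_trichotomy (x - s) 0 with h | h | h
    · nlinarith
    · rw [h] at h5; linarith
    · rcases eq_or_lt_of_le (Int.add_one_le_iff.2 h) with h | h
      · rw [← h] at h5; linarith
      · nlinarith
  rcases Letter.sgn_ofBool b with hσ | hσ
  · rw [hσ] at e1 e2 e3
    obtain rfl : x' = -x := by linarith
    obtain rfl : t = -s - 1 := by linarith
    obtain rfl : n = i + j - 1 - m := by linarith
    exact key x s i j m hi hj (by linarith) bS1 bS2 bu1 bv1 (by linear_combination e1 - e2)
  · rw [hσ] at e1 e2 e3
    obtain rfl : x' = -x := by linarith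
    obtain rfl : t = -s + 1 := by linarith
    obtain rfl : n = i + j - 1 - m := by linarith
    exact key (-x) (-s) i j m hi hj (by linarith) (by linarith) (by linarith) (by linarith)
      (by linarith) (by linear_combination e2 - e1)

theorem powWord_succ (t : List Letter) (i : ℕ) : powWord t (i + 1) = t ++ powWord t i := by
  simp [powWord, List.replicate_succ]

theorem powWord_succ' (t : List Letter) (i : ℕ) : powWord t (i + 1) = powWord t i ++ t := by
  simp [powWord, List.replicate_succ']

theorem powWord_add (t : List Letter) (i j : ℕ) : powWord t (i + j) = powWord t i ++ powWord t j := by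
  rw [powWord, ← List.replicate_append_replicate, List.flatten_append]
  rfl

/-- Euclid's algorithm on the lengths: the shorter word is a prefix of the longer one, and the
remainder still commutes with it. -/
theorem exists_powWord_of_append_comm (u v : List Letter) (h : u ++ v = v ++ u) :
    ∃ t i j, u = powWord t i ∧ v = powWord t j := by
  rcases eq_or_ne u [] with rfl | hu
  · exact ⟨v, 0, 1, rfl, by simp [powWord]⟩
  rcases eq_or_ne v [] with rfl | hv
  · exact ⟨u, 1, 0, by simp [powWord], rfl⟩
  have hu' := List.length_pos_iff.2 hu
  have hv' := List.length_pos_iff.2 hv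
  rcases List.append_eq_append_iff.1 h with ⟨w, hvw, hw⟩ | ⟨w, huw, hw⟩
  · have hl : v.length = u.length + w.length := by simpa using congrArg List.length hvw
    obtain ⟨t, i, j, h1, h2⟩ := exists_powWord_of_append_comm u w (hvw.symm.trans hw)
    exact ⟨t, i, i + j, h1, by rw [hvw, powWord_add, ← h1, ← h2]⟩
  · have hl : u.length = v.length + w.length := by simpa using congrArg List.length huw
    obtain ⟨t, i, j, h1, h2⟩ := exists_powWord_of_append_comm w v (hw.symm.trans huw)
    exact ⟨t, j + i, j, by rw [huw, powWord_add, ← h1, ← h2], h2⟩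
termination_by u.length + v.length
decreasing_by all_goals (simp_wf; omega)

/-- Both hypotheses together make T**S self-dual, and the first makes it equal to S**T. Hence S**
and T** commute and are powers of a common word, which has the form U**; self-duality passes to the
prefix `U`. -/
theorem exists_root_of_isRotated {S T : List Letter} {b : Bool} (hd : dirs (S ++ T) ≠ [])
    (h1 : S ++ [.ofBool b] ++ T ++ stars 2 ~r S ++ stars 2 ++ T ++ [.ofBool b])
    (h2 : S ++ [.ofBool !b] ++ T ++ stars 2 ~r barWord (S ++ stars 2 ++ T ++ [.ofBool b])) :
    ∃ U k, 1 ≤ k ∧ U = barWord U ∧ S ++ stars 2 ++ T = powWord (U ++ stars 2) k ++ U := by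
  have hs : barWord (stars 2) = stars 2 := rfl
  have hST : height S + height T = 0 := by
    have := height_eq_of_isRotated h2
    rw [height_barWord] at this
    simp [stars, List.replicate_succ, Letter.sgn_ofBool_not] at this
    linarith
  have hD : T ++ stars 2 ++ S = barWord (T ++ stars 2 ++ S) := by
    refine eq_barWord_of_isRotated (b := !b) ?_
    have r1 : T ++ stars 2 ++ S ++ [.ofBool !b] ~r S ++ [.ofBool !b] ++ T ++ stars 2 := by
      have := List.isRotated_append (l := T ++ stars 2) (l' := S ++ [.ofBool !b])
      simpa only [List.append_assoc] using this
    have r2 := isRotated_barWord h1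
    have r3 : barWord (S ++ [.ofBool b] ++ T ++ stars 2) ~r
        barWord (T ++ stars 2 ++ S) ++ [.ofBool !b] := by
      have := List.isRotated_append (l := stars 2 ++ barWord T ++ [.ofBool !b]) (l' := barWord S)
      simpa only [barWord_append, hs, barWord_singleton, Letter.bar_ofBool,
        List.append_assoc] using this
    exact r1.trans (h2.trans (r2.symm.trans r3))
  have hR : S ++ stars 2 ++ T = T ++ stars 2 ++ S := by
    refine append_comm_of_isRotated (b := b) hST (h1.symm.trans ?_)
    have := List.isRotated_append (l := S ++ [.ofBool b]) (l' := T ++ stars 2)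
    simpa only [List.append_assoc] using this
  obtain ⟨t, i, j, hi, hj⟩ := exists_powWord_of_append_comm (S ++ stars 2) (T ++ stars 2) (by
    simp only [← List.append_assoc]
    rw [hR])
  obtain ⟨i, rfl⟩ : ∃ i', i = i' + 1 := Nat.exists_eq_succ_of_ne_zero (by
    rintro rfl
    simp [powWord, stars] at hi)
  obtain ⟨j, rfl⟩ : ∃ j', j = j' + 1 := Nat.exists_eq_succ_of_ne_zero (by
    rintro rfl
    simp [powWord, stars] at hj)
  obtain ⟨U, rfl⟩ : ∃ U, t = U ++ stars 2 := by
    rw [powWord_succ'] at hi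
    -- The common root ends in ** unless it has length at most 1. It is not empty, and if it were a
    -- single symmetric letter, then `S` and `T` would be entirely symmetric.
    rcases List.append_eq_append_iff.1 hi with ⟨w, _, hw⟩ | ⟨w, _, hw⟩
    · rcases w with - | ⟨l, - | ⟨l', w⟩⟩
      · exact ⟨[], hw.symm⟩
      · exfalso
        simp [stars, List.replicate_succ] at hw
        obtain ⟨-, rfl⟩ := hw
        have e1 := congrArg dirs hi
        have e2 := congrArg dirs hj
        have : ∀ n, dirs (powWord [Letter.star] n) = [] := fun n => by
          induction n with
          | zero => rfl
          | succ n ih => simp [powWord_succ, ih]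
        simp [this, stars, List.replicate_succ] at e1 e2
        simp [e1, e2] at hd
      · simp [stars, List.replicate_succ] at hw
        obtain ⟨-, -, rfl, rfl⟩ := hw
        simp [powWord, stars] at hi
    · exact ⟨w, hw⟩
  have hRU : S ++ stars 2 ++ T = powWord (U ++ stars 2) (i + 1 + j) ++ U := by
    refine List.append_cancel_right (bs := stars 2) ?_
    rw [List.append_assoc, List.append_assoc _ U, hi, hj, ← powWord_add, ← powWord_succ']
    rfl
  refine ⟨U, i + 1 + j, by omega, ?_, hRU⟩
  rw [← hR, hRU, show i + 1 + j = (i + j) + 1 by ring, powWord_succ] at hD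
  simp only [barWord_append] at hD
  rw [List.append_assoc, List.append_assoc] at hD
  exact (List.append_inj hD (by simp)).1

/-! ### Choosing the directions of the symmetric letters -/

/-- The positions `p` and `q` lie in the same run of symmetric letters. -/
def SameRun (R : List Letter) (p q : ℕ) : Prop :=
  ∀ i, min p q ≤ i → i ≤ max p q → R[i]? = some .star

theorem SameRun.symm {R : List Letter} {p q : ℕ} (h : SameRun R p q) : SameRun R q p := by
  intro i h1 h2
  exact h i (by omega) (by omega)

/-- The block of a letter, with a given direction for a symmetric letter. -/
def Letter.block (c : Bool) : Letter → Block
  | .plus => .dir true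
  | .minus => .dir false
  | .star => .star c

theorem letters_mapIdx_block (e : ℕ → Bool) (R : List Letter) :
    letters (R.mapIdx fun i l => l.block (e i)) = R := by
  refine List.ext_getElem (by simp [letters]) fun i h1 h2 => ?_
  simp only [letters, List.getElem_map, List.getElem_mapIdx]
  cases R[i] <;> rfl

/-- Directions alternate along each run, starting from its first marked position. A run has at most
one mark of each kind, so only a second mark, of the opposite kind, can break the alternation, and
then the first mark lies to its left. -/
theorem exists_directions (R : List Letter) (X : Bool → ℕ → Prop)
    (hX : ∀ z p, X z p → R[p]? = some .star ∧ R[p + 1]? = some .star)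
    (hX' : ∀ p, X true p → ¬ X false p)
    (hX'' : ∀ z p q, X z p → X z q → SameRun R p q → p = q) :
    ∃ e : ℕ → Bool, (∀ p b, R[p + 1]? = some (.ofBool b) → e p = b) ∧ (∀ z p, X z p → e p = z) ∧
      ∀ p, R[p]? = some .star → R[p + 1]? = some .star → R[p + 2]? = some .star →
        e p = e (p + 1) → ∃ q < p, X (!(e p)) q ∧ SameRun R q p := by
  classical
  -- `A p` is the set of marks in the run of `p`. Without marks `sInf` is 0, and `a` still
  -- alternates, which is all that is needed there.
  let A : ℕ → Set ℕ := fun p => {q | (X true q ∨ X false q) ∧ SameRun R p q}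
  let a : ℕ → Bool := fun p =>
    if Even (p + sInf (A p)) then decide (X true (sInf (A p))) else !decide (X true (sInf (A p)))
  let e : ℕ → Bool := fun p =>
    if X true p then true else if X false p then false else
      match R[p + 1]? with
      | some .plus => true
      | some .minus => false
      | _ => a p
  have he1 : ∀ z p, X z p → e p = z := by
    intro z p h
    cases z
    · have : ¬ X true p := fun h' => hX' p h' h
      simp [e, this, h]
    · simp [e, h]
  have he2 : ∀ p, R[p + 1]? = some .star → ¬ (X true p ∨ X false p) → e p = a p := by
    intro p h h'
    rw [not_or] at h'
    simp [e, h'.1, h'.2, h]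
  have key : ∀ p, R[p]? = some .star → R[p + 1]? = some .star → e p = a p ∨
      ∃ q < p, X (!(e p)) q ∧ SameRun R q p := by
    intro p h1 h2
    by_cases hp : X true p ∨ X false p
    · have hA : p ∈ A p := ⟨hp, fun i h3 h4 => by
        obtain rfl : i = p := by omega
        exact h1⟩
      have hm : sInf (A p) ∈ A p := Nat.sInf_mem ⟨p, hA⟩
      have hle : sInf (A p) ≤ p := Nat.sInf_le hA
      rcases hle.lt_or_eq with hlt | heq
      · right
        refine ⟨_, hlt, ?_, hm.2.symm⟩
        have hz : ∀ z, X z p → X (!z) (sInf (A p)) := by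
          intro z hz
          have : ¬ X z (sInf (A p)) := fun h => by
            have := hX'' _ _ _ hz h hm.2
            omega
          rcases hm.1 with h | h <;> cases z <;> first | exact h | exact absurd h this
        rcases hp with h | h
        · rw [he1 _ _ h]; exact hz _ h
        · rw [he1 _ _ h]; exact hz _ h
      · left
        have : Even (p + p) := ⟨p, rfl⟩
        rcases hp with h | h
        · rw [he1 _ _ h]; simp [a, heq, this, h]
        · have h' : ¬ X true p := fun h' => hX' p h' h
          rw [he1 _ _ h]; simp [a, heq, this, h']
    · exact Or.inl (he2 p h2 hp)
  refine ⟨e, ?_, he1, ?_⟩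
  · intro p b h
    have h1 : ∀ z, ¬ X z p := fun z hz => by
      rw [(hX z p hz).2] at h
      simp at h
    simp only [e, h1, if_false, h]
    cases b <;> rfl
  · intro p h0 h1 h2 hep
    have hA : A p = A (p + 1) := by
      ext q
      simp only [A, Set.mem_ofPred_eq, and_congr_right_iff]
      intro hq
      have hq0 : R[q]? = some .star := hq.elim (fun h => (hX _ _ h).1) fun h => (hX _ _ h).1
      constructor
      · intro h i h3 h4
        by_cases hi : i = p + 1
        · rw [hi, h1]
        by_cases hi' : i = q
        · rw [hi', hq0]
        exact h i (by omega) (by omega)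
      · intro h i h3 h4
        by_cases hi : i = p
        · rw [hi, h0]
        by_cases hi' : i = q
        · rw [hi', hq0]
        exact h i (by omega) (by omega)
    have ha : a p ≠ a (p + 1) := by
      have h3 : Even (p + 1 + sInf (A (p + 1))) ↔ ¬ Even (p + sInf (A (p + 1))) := by
        rw [add_right_comm, Nat.even_add_one]
      simp only [a, hA, h3]
      by_cases h4 : Even (p + sInf (A (p + 1)))
      · simp [h4]
      · simp [h4]
    -- Equal neighbours contradict the alternation of `a`, so one of the two positions is a second
    -- mark. The third symmetric letter ensures that the direction at `p + 1` is not forced by a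
    -- non-symmetric successor.
    rcases key p h0 h1 with h | h
    · rcases key (p + 1) h1 h2 with h' | ⟨q, hq, hXq, hr⟩
      · exact absurd (h.symm.trans (hep.trans h')) ha
      · rw [← hep] at hXq
        have hqp : q ≠ p := by
          rintro rfl
          have := he1 _ _ hXq
          simp at this
        exact ⟨q, by omega, hXq, fun i h3 h4 => hr i (by omega) (by omega)⟩
    · exact h

theorem exists_coherent_of_directions (R : List Letter) (e : ℕ → Bool)
    (he : ∀ p b, R[p + 1]? = some (.ofBool b) → e p = b) :
    ∃ L, letters L = R ∧ Coherent L ∧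
      ∀ L₁ L₂ c, L = L₁ ++ .star c :: L₂ → R[L₁.length]? = some .star ∧ c = e L₁.length := by
  have hst : ∀ i c, (R.mapIdx fun i l => l.block (e i))[i]? = some (Block.star c) →
      R[i]? = some .star ∧ c = e i := by
    intro i c h
    rw [List.getElem?_mapIdx, Option.map_eq_some_iff] at h
    obtain ⟨l, hl, h⟩ := h
    cases l <;> simp [Letter.block] at h
    exact ⟨hl, h.symm⟩
  refine ⟨R.mapIdx fun i l => l.block (e i), letters_mapIdx_block e R, ?_, ?_⟩
  · refine List.isChain_iff_getElem.2 fun i hi c b hc hb => ?_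
    have hc' := hst i c (by rw [List.getElem?_eq_getElem (Nat.lt_of_succ_lt hi), hc])
    rw [hc'.2]
    apply he
    rw [List.getElem_mapIdx] at hb
    simp at hi
    rw [List.getElem?_eq_getElem hi]
    generalize R[i + 1] = l at hb
    cases l <;> simp [Letter.block] at hb <;> subst hb <;> rfl
  · intro L₁ L₂ c h
    exact hst L₁.length c (by rw [h]; simp)

/-- The pattern `pat` of `L` does not contain `R`, so the hypothesis fails for it at some factor or
its reversal, and what is not contained does not fit. -/
theorem exists_not_fits {R : List Letter} {y : Letter} {L : List Block} (hL : letters L = R)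
    (hR : R ≠ [])
    (h : ∀ p, (∀ q l₁ l₂, q ++ [l₁, l₂] ~r R ++ [y] → Contains q p ∧ Contains (barWord q) p) →
      Contains R p) :
    ∃ q l₁ l₂, ¬ Fits L q ∧
      (q ++ [l₁, l₂] ~r R ++ [y] ∨ q ++ [l₁, l₂] ~r barWord (R ++ [y])) := by
  subst hL
  by_contra! hc
  have hL0 : L ≠ [] := by
    rintro rfl
    exact hR rfl
  refine not_contains_pat (letters L).length L hL0 (h _ fun q l₁ l₂ hq => ?_)
  have hlen : q.length ≤ (letters L).length := by
    have := hq.perm.length_eq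
    simp only [List.length_append, List.length_cons, List.length_nil] at this
    omega
  constructor
  · refine Fits.contains hlen ?_
    by_contra hf
    exact (hc q l₁ l₂ hf).1 hq
  · refine Fits.contains (by simpa using hlen) ?_
    by_contra hf
    refine (hc (barWord q) l₂.bar l₁.bar hf).2 (List.IsRotated.trans ?_ (isRotated_barWord hq))
    rw [barWord_append]
    exact List.isRotated_append

/-! ### The combinatorial core -/

theorem dirs_eq_nil_of_append_stars_comm {S : List Letter} {d : ℕ} (hd : 0 < d)
    (h : S ++ stars d = stars d ++ S) : dirs S = [] := by
  by_contra hS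
  have := congrArg trail h
  rw [trail_append_stars, trail_append_of_ne hS] at this
  omega

/-- Between two occurrences of ** in the same run there are only symmetric letters. -/
theorem exists_eq_append_stars {S S' T T' : List Letter}
    (h : S ++ stars 2 ++ T = S' ++ stars 2 ++ T') (hl : S.length ≤ S'.length)
    (hr : SameRun (S ++ stars 2 ++ T) S.length S'.length) :
    ∃ d, d + S.length = S'.length ∧ S' = S ++ stars d ∧ T = stars d ++ T' := by
  rw [List.append_assoc, List.append_assoc] at h
  obtain ⟨w, hw, hT⟩ : ∃ w, S' = S ++ w ∧ stars 2 ++ T = w ++ (stars 2 ++ T') := by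
    rcases List.append_eq_append_iff.1 h with h | ⟨w, hw, hT⟩
    · exact h
    · have := congrArg List.length hw
      simp at this
      obtain rfl : w = [] := List.length_eq_zero_iff.1 (by omega)
      exact ⟨[], by simpa using hw.symm, hT.symm⟩
  have hws : w = stars w.length := by
    refine List.eq_replicate_iff.2 ⟨rfl, fun l hlw => ?_⟩
    obtain ⟨i, hi, rfl⟩ := List.getElem_of_mem hlw
    have := hr (S.length + i) (by simp) (by simp [hw]; omega)
    rw [List.append_assoc, hT, List.getElem?_append_right (by omega),
      List.getElem?_append_left (by omega), List.getElem?_eq_getElem (by omega)] at this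
    simpa using this
  refine ⟨w.length, by rw [hw]; simp [add_comm], hws ▸ hw, ?_⟩
  rw [hws, ← List.append_assoc, List.replicate_append_replicate, add_comm,
    ← List.replicate_append_replicate, List.append_assoc] at hT
  simpa using List.append_cancel_left hT

/-- If every pattern that contains all cyclic factors of length `n - 2` of a cyclic word of length
`n`, in both directions, also contains the factor `R` of length `n - 1`, then the cyclic word has a
single non-symmetric letter, or it is `(U**)^k U` followed by a non-symmetric letter. -/
theorem word_form_of_contains {R : List Letter} {y : Letter} (hR : R ≠ [])
    (h : ∀ p, (∀ q l₁ l₂, q ++ [l₁, l₂] ~r R ++ [y] → Contains q p ∧ Contains (barWord q) p) →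
      Contains R p) :
    (dirs (R ++ [y])).length = 1 ∨
      ∃ b U k, y = .ofBool b ∧ 1 ≤ k ∧ U = barWord U ∧ R = powWord (U ++ stars 2) k ++ U := by
  have hlen : ∀ {q : List Letter} {l₁ l₂ : Letter},
      q ++ [l₁, l₂] ~r R ++ [y] ∨ q ++ [l₁, l₂] ~r barWord (R ++ [y]) →
      q.length + 1 = R.length ∧
        (dirs q).length + (dirs [l₁, l₂]).length = (dirs R).length + (dirs [y]).length := by
    intro q l₁ l₂ h
    have h1 : (q ++ [l₁, l₂]).length = (R ++ [y]).length := by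
      rcases h with h | h
      · exact h.perm.length_eq
      · rw [h.perm.length_eq, length_barWord]
    have h2 : (dirs (q ++ [l₁, l₂])).length = (dirs (R ++ [y])).length := by
      rcases h with h | h
      · exact (h.perm.filterMap _).length_eq
      · rw [dirs, (h.perm.filterMap _).length_eq]
        change (dirs _).length = _
        rw [dirs_barWord]
        simp only [List.length_reverse, List.length_map]
    simp at h1
    rw [dirs_append, dirs_append, List.length_append, List.length_append] at h2
    exact ⟨by omega, h2⟩
  rcases y.eq_star_or_ofBool with rfl | ⟨b, rfl⟩
  -- With `y` symmetric, `q` has no more non-symmetric letters than `R`, so it would dominate a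
  -- longer word; any coherent choice of directions will do.
  · exfalso
    obtain ⟨e, he, -⟩ := exists_directions R (fun _ _ => False) (by simp) (by simp) (by simp)
    obtain ⟨L, hL, hLc, -⟩ := exists_coherent_of_directions R e he
    obtain ⟨q, l₁, l₂, hf, hq⟩ := exists_not_fits hL hR h
    obtain ⟨h1, h2⟩ := hlen hq
    simp only [dirs_star_cons, dirs_nil, List.length_nil] at h2
    have := (dominates_of_not_fits hLc (by rw [hL]; omega) hf).length_le
    rw [← hL, length_letters] at h1
    omega
  by_cases hR0 : dirs R = []
  · left
    simp [hR0]
  right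
  have main : ∀ L, letters L = R → Coherent L →
      ∃ L₁ L₂ q₁ q₂ z c, L = L₁ ++ .star (!z) :: .star c :: L₂ ∧
      dirs q₁ = dirs (letters L₁) ∧ dirs q₂ = dirs (letters L₂) ∧
      ((q₁ = letters L₁ ∧ q₂ = letters L₂) ∨
        (c = !z ∧ (∃ c' L₃, L₂ = .star c' :: L₃) ∧ DominatesExact L₁ q₁ ∧
          (dirs (letters L₂) ≠ [] → trail (letters L₂) ≤ trail q₂))) ∧
      (z = b ∨ height R = 0) ∧
      (height R = 0 → q₁ ++ .ofBool z :: (q₂ ++ stars 2) ~r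
        if z = b then R ++ [.ofBool b] else barWord (R ++ [.ofBool b])) := by
    intro L hL hLc
    obtain ⟨q, l₁, l₂, hf, hq⟩ := exists_not_fits hL hR h
    obtain ⟨h1, h2⟩ := hlen hq
    simp only [dirs_ofBool_cons, dirs_nil, List.length_singleton] at h2
    obtain ⟨L₁, L₂, q₁, q₂, z, c, hLL, rfl, hd1, hd2, hc⟩ := eq_or_double_loss_of_not_fits hLc
      (by rw [h1, ← hL, length_letters]) (by rw [hL]; omega) hf
    refine ⟨L₁, L₂, q₁, q₂, z, c, hLL, hd1, hd2, hc, ?_⟩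
    have hRd : dirs R = dirs q₁ ++ dirs q₂ := by
      rw [← hL, hLL]
      simp [hd1, hd2]
    -- `q` already contains all non-symmetric letters of the cyclic word, so the two deleted letters
    -- are symmetric.
    have hl0 : dirs [l₁, l₂] = [] := by
      rw [hRd] at h2
      simp at h2
      exact List.length_eq_zero_iff.1 (by omega)
    have hl := eq_stars_of_dirs_eq_nil hl0
    rw [hl] at hq
    have hh : height R = height q₁ + height q₂ := by
      rw [← height_append]
      exact height_eq_of_dirs_eq (by simpa using hRd)
    have hhq : height (q₁ ++ .ofBool z :: q₂ ++ stars 2) = height R + (Letter.ofBool z).sgn := by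
      rw [hh]
      simp [stars, List.replicate_succ]
      ring
    have e : q₁ ++ .ofBool z :: q₂ ++ stars 2 = q₁ ++ .ofBool z :: (q₂ ++ stars 2) := by simp
    simp only [List.length_cons, List.length_nil] at hq
    -- Heights are invariant under rotation and change sign under `barWord`. For height zero, the
    -- letter `z` therefore reveals in which direction `q` is read.
    rcases hq with hq | hq
    · have := height_eq_of_isRotated hq
      rw [hhq] at this
      simp at this
      have hz : z = b := by
        cases z <;> cases b <;> simp [Letter.ofBool, Letter.sgn] at this ⊢
      rw [if_pos hz, ← e]
      exact ⟨Or.inl hz, fun _ => hq⟩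
    · have := height_eq_of_isRotated hq
      rw [hhq, height_barWord] at this
      simp at this
      by_cases hz : z = b
      · subst hz
        refine ⟨Or.inl rfl, fun h0 => ?_⟩
        rcases z.eq_false_or_eq_true with hz | hz <;> simp [h0, hz, Letter.ofBool, Letter.sgn] at this
      · rw [if_neg hz, ← e]
        refine ⟨Or.inr ?_, fun _ => hq⟩
        cases z <;> cases b <;> simp [Letter.ofBool, Letter.sgn] at this hz ⊢ <;> omega
  by_cases hh : height R = 0
  swap
  · exfalso
    -- Only `z = b` can occur now. A star block followed by another gets the direction `b`, so no
    -- block of direction `!b` is available for the loss.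
    let e : ℕ → Bool := fun p =>
      match R[p + 1]? with
      | some .plus => true
      | some .minus => false
      | _ => b
    obtain ⟨L, hL, hLc, he⟩ := exists_coherent_of_directions R e (fun p c h => by
      simp only [e, h]
      cases c <;> rfl)
    obtain ⟨L₁, L₂, q₁, q₂, z, c, hLL, -, -, -, hz, -⟩ := main L hL hLc
    obtain rfl := hz.resolve_right hh
    have h1 := (he _ _ _ hLL).2
    have h2 := (he (L₁ ++ [.star (!z)]) L₂ c (by simp [hLL])).1
    simp at h2
    simp [e, h2] at h1
  let V : Bool → List Letter := fun z =>
    if z = b then R ++ [.ofBool b] else barWord (R ++ [.ofBool b])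
  -- The mark `X z p` says that contracting ** at `p` to `z` gives a factor in the reading `V z`. A
  -- star of direction `z` at `p` keeps that factor from escaping the pattern, since only stars of
  -- direction `!z` lose `z`.
  let X : Bool → ℕ → Prop := fun z p => ∃ S T, R = S ++ stars 2 ++ T ∧ S.length = p ∧
    S ++ .ofBool z :: (T ++ stars 2) ~r V z
  by_cases hX2 : ∃ p, X true p ∧ X false p
  · obtain ⟨p, hp⟩ := hX2
    obtain ⟨⟨S, T, hRS, hS, h1⟩, ⟨S', T', hRS', hS', h2⟩⟩ : X b p ∧ X (!b) p := by
      cases b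
      · exact hp.symm
      · exact hp
    have h3 := hRS.symm.trans hRS'
    rw [List.append_assoc, List.append_assoc] at h3
    obtain ⟨rfl, h4⟩ := List.append_inj h3 (hS.trans hS'.symm)
    obtain rfl := List.append_cancel_left h4
    obtain ⟨U, k, hk, hU, hUk⟩ := exists_root_of_isRotated (S := S) (T := T) (b := b)
      (by
        rw [hRS] at hR0
        simpa using hR0)
      (by simpa [V, hRS] using h1) (by simpa [V, hRS] using h2)
    exact ⟨b, U, k, rfl, hk, hU, hRS.trans hUk⟩
  exfalso
  have hXR : ∀ {S T : List Letter} {z : Bool}, R = S ++ stars 2 ++ T →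
      height (S ++ .ofBool z :: T) = 1 ∨ height (S ++ .ofBool z :: T) = -1 := by
    intro S T z h
    have h0 : height S + height T = 0 := by
      rw [h] at hh
      simpa [stars, List.replicate_succ] using hh
    have : height (S ++ .ofBool z :: T) = (Letter.ofBool z).sgn := by
      simp
      linarith
    rw [this]
    exact Letter.sgn_ofBool z
  -- Two marks of the same kind in one run would make `S` and `T'` commute with a nonempty word of
  -- symmetric letters, so `R` would be entirely symmetric.
  have huniq : ∀ z p q, p ≤ q → X z p → X z q → SameRun R p q → p = q := by
    rintro z _ _ hpq ⟨S, T, hRS, rfl, h1⟩ ⟨S', T', hRS', rfl, h2⟩ hr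
    obtain ⟨d, hd, rfl, rfl⟩ := exists_eq_append_stars (hRS.symm.trans hRS') hpq (hRS ▸ hr)
    obtain ⟨k, ⟨hk, -⟩ | ⟨hk, hk'⟩⟩ := eq_stars_append_of_isRotated (h1.trans h2.symm)
      (by simp) (by simp) (hXR hRS)
    · have := congrArg List.length hk
      simp at this
      omega
    · have := congrArg List.length hk
      simp at this
      obtain rfl : k = d := by omega
      by_contra hne
      have hd0 : 0 < k := by omega
      have e1 := dirs_eq_nil_of_append_stars_comm hd0 hk
      have e2 := dirs_eq_nil_of_append_stars_comm hd0 hk'.symm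
      rw [hRS] at hR0
      simp [e1, e2] at hR0
  obtain ⟨e, he1, he2, he3⟩ := exists_directions R X
    (by
      rintro z _ ⟨S, T, hRS, rfl, -⟩
      rw [hRS]
      simp [stars, List.replicate_succ])
    (fun p h1 h2 => hX2 ⟨p, h1, h2⟩)
    (fun z p q h1 h2 h3 => by
      rcases le_total p q with hpq | hpq
      · exact huniq z p q hpq h1 h2 h3
      · exact (huniq z q p hpq h2 h1 h3.symm).symm)
  obtain ⟨L, hL, hLc, hLe⟩ := exists_coherent_of_directions R e he1
  obtain ⟨L₁, L₂, q₁, q₂, z, c, hLL, hd1, hd2, hc, -, hrot⟩ := main L hL hLc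
  replace hrot := hrot hh
  have hRL : R = letters L₁ ++ stars 2 ++ letters L₂ := by
    rw [← hL, hLL]
    simp [stars, List.replicate_succ]
  have a1 := hLe _ _ _ hLL
  have a2 := hLe (L₁ ++ [.star (!z)]) L₂ c (by simp [hLL])
  -- A contraction contradicts the direction chosen at its mark. A double loss forces a mark of kind
  -- `z` to its left in the same run; `q` and the contraction at that mark then differ by moving
  -- symmetric letters around the cycle, which the lengths and the numbers of trailing symmetric
  -- letters exclude.
  rcases hc with ⟨rfl, rfl⟩ | ⟨rfl, ⟨c', L₃, rfl⟩, hdom, htr⟩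
  · have := he2 z L₁.length ⟨_, _, hRL, by simp, hrot⟩
    rw [this] at a1
    simp at a1
  · have a3 := hLe (L₁ ++ [.star (!z), .star (!z)]) L₃ c' (by simp [hLL])
    simp at a2 a3
    obtain ⟨p, hp, ⟨S, T, hRS, rfl, hS⟩, hr⟩ := he3 _ a1.1 a2.1 a3.1 (by rw [← a1.2, a2.2, Bool.not_not])
    rw [← a1.2, Bool.not_not] at hS
    obtain ⟨d, hd, hLS, hT⟩ := exists_eq_append_stars (hRS.symm.trans hRL)
      (by simpa using hp.le) (by rw [← hRS]; simpa using hr)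
    simp at hd
    obtain ⟨k, ⟨hk, hk'⟩ | ⟨hk, -⟩⟩ := eq_stars_append_of_isRotated (hrot.trans hS.symm)
      (by rw [hd1, hLS]; simp) (by rw [hd2, hT]; simp) (by
        have := hXR (z := z) hRL
        rwa [height_eq_of_dirs_eq (W := letters L₁ ++ .ofBool z :: letters (.star c' :: L₃))
          (by simp [hd1, hd2])])
    · have hl := hdom.length_le
      rw [hk] at hl
      simp at hl
      by_cases hd0 : dirs (letters (.star c' :: L₃)) = []
      · have hS0 : dirs S ≠ [] := by
          intro hS0
          rw [hRS, hT] at hR0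
          simp [hS0] at hR0
          exact hR0 (by simpa using hd0)
        have := hdom.trail_eq
        rw [hLS, hk, trail_append_stars, trail_append_of_ne hS0] at this
        omega
      · have := htr hd0
        rw [← trail_append_of_ne (V := stars d) hd0, ← hT, hk', trail_append_stars] at this
        omega
    · have hl := hdom.length_le
      have := congrArg List.length hk
      simp at this
      omega

/-! ### Unrolled cycles -/

theorem Letter.fwd_iff (l : Letter) : l.Fwd ↔ l.allows true = true := by
  cases l <;> simp [Letter.Fwd, Letter.allows]

theorem Letter.bwd_iff (l : Letter) : l.Bwd ↔ l.allows false = true := by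
  cases l <;> simp [Letter.Bwd, Letter.allows]

/-- The digraph `G` is a reflexive `n`-cycle, unrolled: `π` runs through its vertices in cyclic
order, and the letter `w i` describes the arcs between `π i` and `π (i + 1)`. -/
structure Wound {V : Type*} (G : Digraph V) (n : ℕ) (π : ℤ → V) (w : ℤ → Letter) : Prop where
  three_le : 3 ≤ n
  surjective : Function.Surjective π
  eq_iff : ∀ i j, π i = π j ↔ (n : ℤ) ∣ j - i
  periodic : ∀ i, w (i + n) = w i
  adj_iff : ∀ i j, G.Adj (π i) (π j) ↔ (n : ℤ) ∣ j - i ∨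
    ((n : ℤ) ∣ j - i - 1 ∧ (w i).allows true = true) ∨
    ((n : ℤ) ∣ i - j - 1 ∧ (w j).allows false = true)

namespace Wound

variable {V : Type*} {G : Digraph V} {n : ℕ} {π : ℤ → V} {w : ℤ → Letter}

theorem eq_of_dvd (h : Wound G n π w) {i j : ℤ} (hij : (n : ℤ) ∣ j - i) : w i = w j := by
  obtain ⟨k, hk⟩ := hij
  rw [show j = i + k * n by linarith]
  exact ((show Function.Periodic w n from h.periodic).int_mul k i).symm

theorem shift (h : Wound G n π w) (c : ℤ) :
    Wound G n (fun i => π (c + i)) (fun i => w (c + i)) where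
  three_le := h.three_le
  surjective x := by
    obtain ⟨i, rfl⟩ := h.surjective x
    exact ⟨i - c, by simp⟩
  eq_iff i j := by rw [h.eq_iff, add_sub_add_left_eq_sub]
  periodic i := by rw [← add_assoc, h.periodic]
  adj_iff i j := by rw [h.adj_iff, add_sub_add_left_eq_sub, add_sub_add_left_eq_sub]

theorem reflect (h : Wound G n π w) :
    Wound G n (fun i => π (-i)) (fun i => (w (-i - 1)).bar) where
  three_le := h.three_le
  surjective x := by
    obtain ⟨i, rfl⟩ := h.surjective x
    exact ⟨-i, by simp⟩
  eq_iff i j := by rw [h.eq_iff, ← dvd_neg]; ring_nf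
  periodic i := by rw [← h.periodic]; ring_nf
  adj_iff i j := by
    rw [h.adj_iff, ← dvd_neg]
    simp only [Letter.allows_bar, Bool.not_true, Bool.not_false]
    have e1 : -(-j - -i) = j - i := by ring
    have e2 : -j - -i - 1 = i - j - 1 := by ring
    have e3 : -i - -j - 1 = j - i - 1 := by ring
    rw [e1, e2, e3, or_comm (a := _ ∧ _)]
    refine or_congr_right (or_congr (and_congr_right fun hd => ?_) (and_congr_right fun hd => ?_))
    · rw [h.eq_of_dvd (i := -j) (j := -i - 1)
        (by rwa [show -i - 1 - -j = j - i - 1 by ring])]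
    · rw [h.eq_of_dvd (i := -i) (j := -j - 1)
        (by rwa [show -j - 1 - -i = i - j - 1 by ring])]

theorem map {V' : Type*} {G' : Digraph V'} (h : Wound G n π w) (e : G.Adj ≃r G'.Adj) :
    Wound G' n (fun i => e (π i)) w where
  three_le := h.three_le
  surjective := e.surjective.comp h.surjective
  eq_iff i j := by rw [e.injective.eq_iff, h.eq_iff]
  periodic := h.periodic
  adj_iff i j := by rw [e.map_rel_iff, h.adj_iff]

/-- Unrolled cycles with the same letters are isomorphic. -/
theorem isomorphic {V' : Type*} {G' : Digraph V'} {π' : ℤ → V'} (h : Wound G n π w)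
    (h' : Wound G' n π' w) : Isomorphic G G' := by
  have e1 : ∀ x, π (Function.surjInv h.surjective x) = x := Function.surjInv_eq _
  have e2 : ∀ x, π' (Function.surjInv h'.surjective x) = x := Function.surjInv_eq _
  refine ⟨⟨⟨fun x => π' (Function.surjInv h.surjective x),
    fun x => π (Function.surjInv h'.surjective x), fun x => ?_, fun x => ?_⟩, fun {x y} => ?_⟩⟩
  · conv_rhs => rw [← e1 x]
    rw [h.eq_iff, ← h'.eq_iff, e2]
  · conv_rhs => rw [← e2 x]
    rw [h'.eq_iff, ← h.eq_iff, e1]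
  · change G'.Adj (π' _) (π' _) ↔ _
    rw [h'.adj_iff, ← h.adj_iff, e1, e1]

theorem adj_succ_iff (h : Wound G n π w) (i : ℤ) :
    G.Adj (π i) (π (i + 1)) ↔ (w i).allows true = true := by
  have := h.three_le
  rw [h.adj_iff]
  refine ⟨?_, fun h => Or.inr (Or.inl ⟨by simp, h⟩)⟩
  rintro (⟨k, hk⟩ | ⟨-, h⟩ | ⟨⟨k, hk⟩, -⟩)
  · have := Int.isUnit_iff.1 (IsUnit.of_mul_eq_one k (by linarith : (n : ℤ) * k = 1))
    omega
  · exact h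
  · have h2 : (n : ℤ) ∣ 2 := ⟨-k, by linarith⟩
    have := Int.le_of_dvd (by norm_num) h2
    omega

theorem succ_adj_iff (h : Wound G n π w) (i : ℤ) :
    G.Adj (π (i + 1)) (π i) ↔ (w i).allows false = true := by
  have := h.reflect.adj_succ_iff (-i - 1)
  simp only [Letter.allows_bar, Bool.not_true] at this
  convert this using 3 <;> ring_nf

theorem ext_letters (h : Wound G n π w) {w' : ℤ → Letter} (hw : ∀ i, w' (i + n) = w' i)
    (hww : ∀ i : ℕ, i < n → w i = w' i) : w = w' := by
  have hn : 0 < n := by have := h.three_le; omega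
  have key : ∀ {v : ℤ → Letter}, (∀ i, v (i + n) = v i) → ∀ i, v (i % n) = v i := by
    intro v hv i
    have : v (i % n + (i / n) * n) = v (i % n) :=
      (show Function.Periodic v n from hv).int_mul (i / n) (i % n)
    rwa [Int.emod_add_ediv_mul, eq_comm] at this
  funext i
  obtain ⟨m, hm⟩ := Int.eq_ofNat_of_zero_le (Int.emod_nonneg i (by omega : (n : ℤ) ≠ 0))
  have := Int.emod_lt_of_pos i (by omega : (0 : ℤ) < n)
  rw [← key hw, ← key h.periodic, hm, hww m (by omega)]

end Wound

/-- The vertex of an `n`-cycle with a given position. -/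
def windFin {n : ℕ} (hn : 0 < n) (i : ℤ) : Fin n :=
  ⟨(i % n).toNat, by
    have h1 := Int.emod_lt_of_pos i (by omega : (0 : ℤ) < n)
    omega⟩

section windFin

variable {n : ℕ} (hn : 0 < n)

theorem coe_windFin (i : ℤ) : ((windFin hn i).val : ℤ) = i % n :=
  Int.toNat_of_nonneg (Int.emod_nonneg i (by omega))

theorem windFin_coe (i : Fin n) : windFin hn i.val = i := by
  apply Fin.ext
  zify
  rw [coe_windFin]
  exact Int.emod_eq_of_lt (by omega) (by omega)

theorem windFin_eq_iff (i j : ℤ) : windFin hn i = windFin hn j ↔ (n : ℤ) ∣ j - i := by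
  rw [Fin.ext_iff, ← Int.natCast_inj, coe_windFin, coe_windFin]
  exact Int.modEq_iff_dvd

theorem cyclicSucc_windFin_iff (i j : ℤ) :
    CyclicSucc (windFin hn i) (windFin hn j) ↔ (n : ℤ) ∣ j - i - 1 := by
  rw [CyclicSucc, ← Int.natCast_inj]
  push_cast
  rw [coe_windFin, coe_windFin, Int.emod_add_emod, eq_comm, sub_sub]
  exact Int.modEq_iff_dvd

end windFin

open Classical in
theorem IsCycle.exists_wound {n : ℕ} {G : Digraph (Fin n)} (hn : 3 ≤ n) (hG : IsCycle G) :
    ∃ π w, Wound G n π w := by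
  have hn0 : 0 < n := by omega
  have hper : ∀ i : ℤ, windFin hn0 (i + n) = windFin hn0 i := fun i => by
    rw [windFin_eq_iff]; simp
  refine ⟨windFin hn0, fun i => if G.Adj (windFin hn0 i) (windFin hn0 (i + 1)) then
    if G.Adj (windFin hn0 (i + 1)) (windFin hn0 i) then .star else .plus else .minus, hn,
    fun x => ⟨_, windFin_coe hn0 x⟩, windFin_eq_iff hn0, fun i => ?_, fun i j => ?_⟩
  · simp only [hper, add_right_comm i (n : ℤ) 1]
  · have hs : ∀ i j : ℤ, (n : ℤ) ∣ j - i - 1 → windFin hn0 j = windFin hn0 (i + 1) ∧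
        (G.Adj (windFin hn0 i) (windFin hn0 j) ∨ G.Adj (windFin hn0 j) (windFin hn0 i)) := by
      intro i j h
      refine ⟨?_, hG.consec _ _ ((cyclicSucc_windFin_iff hn0 i j).2 h)⟩
      rw [windFin_eq_iff, ← dvd_neg, neg_sub, ← sub_sub]
      exact h
    constructor
    · intro h
      rcases hG.noOther _ _ h with h1 | h1 | h1
      · exact Or.inl ((windFin_eq_iff hn0 i j).1 h1)
      · have h2 := (cyclicSucc_windFin_iff hn0 i j).1 h1
        refine Or.inr (Or.inl ⟨h2, ?_⟩)
        rw [(hs i j h2).1] at h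
        simp only [if_pos h]
        split_ifs <;> rfl
      · have h2 := (cyclicSucc_windFin_iff hn0 j i).1 h1
        refine Or.inr (Or.inr ⟨h2, ?_⟩)
        rw [(hs j i h2).1] at h
        simp only [if_pos h]
        split_ifs <;> rfl
    · rintro (h | ⟨h, h'⟩ | ⟨h, h'⟩)
      · rw [(windFin_eq_iff hn0 i j).2 h]
        exact hG.refl _
      · rw [(hs i j h).1]
        by_contra hc
        simp [hc, Letter.allows] at h'
      · obtain ⟨h1, h2⟩ := hs j i h
        rw [h1] at h2 ⊢
        by_contra hc
        simp [hc, h2.resolve_right hc, Letter.allows] at h'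

theorem wound_cycleOfWord {W : List Letter} (hW : 3 ≤ W.length) :
    ∃ π w, Wound (cycleOfWord W) W.length π w ∧ ∀ i : Fin W.length, w i.val = W.get i := by
  have hn0 : 0 < W.length := by omega
  refine ⟨windFin hn0, fun i => W.get (windFin hn0 i), ⟨hW, fun x => ⟨_, windFin_coe hn0 x⟩,
    windFin_eq_iff hn0, fun i => ?_, fun i j => ?_⟩, fun i => by simp only [windFin_coe]⟩
  · have : windFin hn0 (i + W.length) = windFin hn0 i := by
      rw [windFin_eq_iff]; simp
    rw [this]
  · rw [← windFin_eq_iff hn0, ← cyclicSucc_windFin_iff hn0, ← cyclicSucc_windFin_iff hn0,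
      ← Letter.fwd_iff, ← Letter.bwd_iff]
    rfl

/-! ### Factors of a periodic word -/

/-- The factor of length `k` of the infinite word `w` that starts at `c`. -/
def factor (w : ℤ → Letter) (c : ℤ) (k : ℕ) : List Letter := (List.range k).map fun i : ℕ => w (c + i)

section factor

variable (w : ℤ → Letter) (c : ℤ)

@[simp] theorem length_factor (k : ℕ) : (factor w c k).length = k := by simp [factor]

@[simp] theorem factor_zero : factor w c 0 = [] := rfl

theorem getElem_factor {k i : ℕ} (h : i < (factor w c k).length) :
    (factor w c k)[i] = w (c + i) := by
  simp [factor]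

theorem getElem?_factor {k i : ℕ} (h : i < k) : (factor w c k)[i]? = some (w (c + i)) := by
  rw [List.getElem?_eq_getElem (by simpa using h), getElem_factor]

theorem factor_succ (k : ℕ) : factor w c (k + 1) = w c :: factor w (c + 1) k := by
  simp [factor, List.range_succ_eq_map, add_assoc, add_comm (1 : ℤ), Function.comp_def]

theorem factor_add (k l : ℕ) : factor w c (k + l) = factor w c k ++ factor w (c + k) l := by
  simp [factor, List.range_add, add_assoc, Function.comp_def]

theorem factor_succ' (k : ℕ) : factor w c (k + 1) = factor w c k ++ [w (c + k)] := by
  rw [factor_add, factor_succ, factor_zero]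

theorem barWord_factor (k : ℕ) :
    barWord (factor w c k) = factor (fun i => (w (-i - 1)).bar) (-c - k) k := by
  induction k with
  | zero => rfl
  | succ k ih =>
    rw [factor_succ', barWord_append, ih, barWord_singleton, factor_succ, List.singleton_append]
    push_cast
    congr 3 <;> ring

variable {w c}

theorem eq_factor_of_isRotated {n : ℕ} (hw : ∀ i, w (i + n) = w i) {W : List Letter}
    (h : W ~r factor w c n) : ∃ c', W = factor w c' n := by
  obtain ⟨m, rfl⟩ := h.symm
  induction m with
  | zero => exact ⟨c, by simp⟩
  | succ m ih =>
    obtain ⟨c', hc'⟩ := ih (List.IsRotated.symm ⟨m, rfl⟩)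
    cases n with
    | zero => exact ⟨c, by simp⟩
    | succ n =>
      refine ⟨c' + 1, ?_⟩
      rw [← List.rotate_rotate, hc', factor_succ, List.rotate_cons_succ, List.rotate_zero,
        factor_succ', ← hw c']
      push_cast
      congr 3
      ring

theorem isRotated_factor {n : ℕ} (hw : ∀ i, w (i + n) = w i) (c c' : ℤ) :
    factor w c' n ~r factor w c n := by
  have key : ∀ (m : ℕ) (c : ℤ), factor w (c + m) n ~r factor w c n := by
    intro m c
    induction m with
    | zero => rw [Nat.cast_zero, add_zero]
    | succ m ih =>
      refine List.IsRotated.trans ?_ ih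
      cases n with
      | zero => simp
      | succ n =>
        rw [factor_succ w (c + m), factor_succ']
        have : w (c + (m + 1 : ℕ) + n) = w (c + m) := by
          rw [← hw (c + m)]
          push_cast
          ring_nf
        rw [this, Nat.cast_succ, ← add_assoc]
        exact (List.isRotated_append (l := [_])).symm
  rcases le_total c c' with h | h
  · obtain ⟨m, hm⟩ := Int.eq_ofNat_of_zero_le (sub_nonneg.2 h)
    rw [show c' = c + m by linarith]
    exact key m c
  · obtain ⟨m, hm⟩ := Int.eq_ofNat_of_zero_le (sub_nonneg.2 h)
    rw [show c = c' + m by linarith]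
    exact (key m c').symm

end factor

/-! ### Paths with given letters -/

/-- There is an arc from `i` to `j` in the infinite path with the letters `u`. -/
def Near (u : ℕ → Letter) (i j : ℕ) : Prop :=
  i = j ∨ (j = i + 1 ∧ (u i).allows true = true) ∨ (i = j + 1 ∧ (u j).allows false = true)

/-- The path of length `k` with the letters `u`. -/
def pathOfFn (u : ℕ → Letter) (k : ℕ) : Digraph (Fin (k + 1)) where
  Adj i j := Near u i j

theorem isPath_pathOfFn (u : ℕ → Letter) (k : ℕ) : IsPath (pathOfFn u k) where
  refl i := Or.inl rfl
  consec i := by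
    rcases h : u i with _ | _ | _
    · exact Or.inl (Or.inr (Or.inl ⟨rfl, by simp [h, Letter.allows]⟩))
    · exact Or.inr (Or.inr (Or.inr ⟨rfl, by simp [h, Letter.allows]⟩))
    · exact Or.inl (Or.inr (Or.inl ⟨rfl, by simp [h, Letter.allows]⟩))
  noOther i j h := by
    rcases h with h | h | h
    · exact Or.inl (Fin.ext h)
    · exact Or.inr (Or.inl h.1.symm)
    · exact Or.inr (Or.inr h.1.symm)

theorem pathWord_pathOfFn (u : ℕ → Letter) (k : ℕ) :
    pathWord (pathOfFn u k) = (List.range k).map u := by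
  refine List.ext_getElem (by simp [pathWord]) fun i h1 h2 => ?_
  have e1 : ∀ i, Near u i (i + 1) ↔ (u i).allows true = true := by
    intro i
    simp [Near, show ∀ i : ℕ, i ≠ i + 1 + 1 by omega]
  have e2 : ∀ i, Near u (i + 1) i ↔ (u i).allows false = true := by
    intro i
    simp [Near, show ∀ i : ℕ, i ≠ i + 1 + 1 by omega]
  simp only [pathWord, pathOfFn, List.getElem_ofFn, Fin.val_castSucc, Fin.val_succ, e1, e2,
    List.getElem_map, List.getElem_range]
  cases u i <;> simp [Letter.allows]

/-! ### Folding two paths onto a longer one -/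

/-- The word `w` with the letters number `a` and `a + 1` replaced by the letter `l`. -/
def contractAt (w : ℕ → Letter) (a : ℕ) (l : Letter) (i : ℕ) : Letter :=
  if i < a then w i else if i = a then l else w (i + 1)

/-- A homomorphism from the product of the two paths with letters `contractAt w a .plus` and
`contractAt w a .minus` onto the path with letters `w`, if these are symmetric at `a`, `a + 1`. -/
def fold (a x y : ℕ) : ℕ :=
  if x ≤ a ∧ y ≤ a then max x y else if a < x ∧ a < y then min x y + 1 else a + 1

/-- Below the contracted edge `max` preserves arcs, above it `min` does, and all mixed pairs go to
the middle vertex `a + 1`, whose two edges are symmetric. No arc joins the lower quadrant to the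
upper one directly, because the contracted edges have opposite directions in the two factors. -/
theorem near_fold {w : ℕ → Letter} {a : ℕ} (h1 : w a = .star) (h2 : w (a + 1) = .star)
    {x x' y y' : ℕ} (hx : Near (contractAt w a .plus) x x')
    (hy : Near (contractAt w a .minus) y y') : Near w (fold a x y) (fold a x' y') := by
  have e1 : (w a).allows true = true := by rw [h1]; rfl
  have e2 : (w a).allows false = true := by rw [h1]; rfl
  have e3 : (w (a + 1)).allows true = true := by rw [h2]; rfl
  have e4 : (w (a + 1)).allows false = true := by rw [h2]; rfl
  have e5 : Letter.plus.allows false = false := rfl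
  have e6 : Letter.minus.allows true = false := rfl
  rcases hx with rfl | ⟨rfl, hx⟩ | ⟨rfl, hx⟩ <;> rcases hy with rfl | ⟨rfl, hy⟩ | ⟨rfl, hy⟩
  all_goals grind [Near, fold, contractAt]

theorem exists_fold_eq {a n i : ℕ} (hi : i < n) (ha : a + 3 ≤ n) :
    ∃ x y, x ≤ n - 2 ∧ y ≤ n - 2 ∧ fold a x y = i := by
  rcases lt_trichotomy i (a + 1) with h | h | h
  · exact ⟨i, i, by omega, by omega, by unfold fold; split_ifs <;> omega⟩
  · exact ⟨a + 1, a, by omega, by omega, by unfold fold; split_ifs <;> omega⟩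
  · exact ⟨i - 1, i - 1, by omega, by omega, by unfold fold; split_ifs <;> omega⟩

theorem dvd_iff_eq_zero {n : ℕ} {z : ℤ} (hz : |z| < n) : (n : ℤ) ∣ z ↔ z = 0 :=
  ⟨fun h => Int.eq_zero_of_abs_lt_dvd h hz, fun h => h ▸ dvd_zero _⟩

namespace Wound

variable {V : Type*} {G : Digraph V} {n : ℕ} {π : ℤ → V} {w : ℤ → Letter}

/-- Since `k + 2 ≤ n`, the differences involved are smaller than `n` in absolute value, and no arc
wraps around the cycle. -/
theorem adj_iff_near (h : Wound G n π w) {u : ℕ → Letter} {k i j : ℕ} (hk : k + 2 ≤ n)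
    (hu : ∀ i : ℕ, i < k → u i = w i) (hi : i ≤ k) (hj : j ≤ k) :
    G.Adj (π i) (π j) ↔ Near u i j := by
  rw [h.adj_iff, dvd_iff_eq_zero (abs_lt.2 ⟨by omega, by omega⟩),
    dvd_iff_eq_zero (abs_lt.2 ⟨by omega, by omega⟩),
    dvd_iff_eq_zero (abs_lt.2 ⟨by omega, by omega⟩), Near]
  refine or_congr (by omega) (or_congr ?_ ?_)
  · constructor
    · rintro ⟨h1, h2⟩
      rw [hu _ (by omega)]
      exact ⟨by omega, h2⟩
    · rintro ⟨h1, h2⟩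
      rw [hu _ (by omega)] at h2
      exact ⟨by omega, h2⟩
  · constructor
    · rintro ⟨h1, h2⟩
      rw [hu _ (by omega)]
      exact ⟨by omega, h2⟩
    · rintro ⟨h1, h2⟩
      rw [hu _ (by omega)] at h2
      exact ⟨by omega, h2⟩

theorem embeds_pathOfFn (h : Wound G n π w) {u : ℕ → Letter} {k : ℕ} (hk : k + 2 ≤ n)
    (hu : ∀ i : ℕ, i < k → u i = w i) : Embeds (pathOfFn u k) G := by
  refine ⟨⟨⟨fun i => π i.val, fun i j hij => ?_⟩,
    fun {i j} => h.adj_iff_near hk hu i.is_le j.is_le⟩⟩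
  simp only [h.eq_iff] at hij
  rw [dvd_iff_eq_zero (abs_lt.2 ⟨by omega, by omega⟩)] at hij
  exact Fin.ext (by omega)

theorem adj_of_near (h : Wound G n π w) {i j : ℕ} (hij : Near (fun i => w i) i j) :
    G.Adj (π i) (π j) := by
  rw [h.adj_iff]
  rcases hij with rfl | ⟨rfl, hij⟩ | ⟨rfl, hij⟩
  · simp
  · exact Or.inr (Or.inl ⟨by simp, hij⟩)
  · exact Or.inr (Or.inr ⟨by simp, hij⟩)

theorem exists_lt_eq (h : Wound G n π w) (x : V) : ∃ i : ℕ, i < n ∧ π i = x := by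
  obtain ⟨i, rfl⟩ := h.surjective x
  have hn : (0 : ℤ) < n := by have := h.three_le; omega
  obtain ⟨m, hm⟩ := Int.eq_ofNat_of_zero_le (Int.emod_nonneg i hn.ne')
  have := Int.emod_lt_of_pos i hn
  refine ⟨m, by omega, ?_⟩
  rw [h.eq_iff, ← hm]
  exact Int.dvd_self_sub_emod

theorem embeds_of_isRotated (h : Wound G n π w) {u : ℕ → Letter} {k : ℕ} {l₁ l₂ : Letter}
    (hk : k + 2 = n)
    (hu : (List.range k).map u ++ [l₁, l₂] ~r factor w 0 n ∨
      (List.range k).map u ++ [l₁, l₂] ~r barWord (factor w 0 n)) :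
    Embeds (pathOfFn u k) G := by
  have key : ∀ {π w}, Wound G n π w → ∀ c, (List.range k).map u ++ [l₁, l₂] ~r factor w c n →
      Embeds (pathOfFn u k) G := by
    intro π w h c hu
    obtain ⟨c', hc⟩ := eq_factor_of_isRotated h.periodic hu
    refine (h.shift c').embeds_pathOfFn hk.le fun i hi => ?_
    have := congrArg (fun W => W[i]?) hc
    rw [getElem?_factor _ _ (by omega), List.getElem?_append_left (by simpa using hi)] at this
    simpa [hi] using this
  rcases hu with hu | hu
  · exact key h 0 hu
  · rw [barWord_factor] at hu
    exact key h.reflect _ hu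

/-- If both words obtained from a cyclic word `S**Ty` by replacing `**` by a single non-symmetric
letter and deleting `y` are factors of the cyclic word, up to reversal, then the cycle fails the
path condition. -/
theorem not_pathCondition {G : Digraph (Fin n)} {π : ℤ → Fin n} (h : Wound G n π w)
    {S T : List Letter} {y : Letter} (hV : S ++ stars 2 ++ T ++ [y] = factor w 0 n)
    (hST : ∀ b, ∃ l₁ l₂, S ++ .ofBool b :: (T ++ [l₁, l₂]) ~r factor w 0 n ∨
      S ++ .ofBool b :: (T ++ [l₁, l₂]) ~r barWord (factor w 0 n)) :
    ¬ PathCondition G := by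
  have hlen := congrArg List.length hV
  simp at hlen
  have hget : ∀ i : ℕ, i < n → (S ++ stars 2 ++ T ++ [y])[i]? = some (w i) := by
    intro i hi
    rw [hV, getElem?_factor _ _ hi, zero_add]
  have h1 : w (S.length : ℕ) = .star := by
    have := hget S.length (by omega)
    simpa [stars, List.replicate_succ] using this.symm
  have h2 : w (S.length + 1 : ℕ) = .star := by
    have := hget (S.length + 1) (by omega)
    simpa [stars, List.replicate_succ] using this.symm
  let v : ℕ → Letter := fun i => w i
  have hcon : ∀ b, (List.range (n - 2)).map (contractAt v S.length (.ofBool b)) =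
      S ++ .ofBool b :: T := by
    intro b
    refine List.ext_getElem (by simp; omega) fun i hi hi' => ?_
    simp at hi
    simp only [List.getElem_map, List.getElem_range, contractAt, v]
    split_ifs with hS hS
    · have := hget i (by omega)
      simp only [List.append_assoc] at this
      rw [List.getElem?_append_left hS, List.getElem?_eq_getElem hS] at this
      rw [List.getElem_append_left hS]
      exact (Option.some.inj this).symm
    · subst hS
      simp
    · have := hget (i + 1) (by omega)
      rw [List.append_assoc, List.getElem?_append_right (by simp; omega),
        List.getElem?_append_left (by simp; omega)] at this
      rw [List.getElem_append_right (by omega), ← Option.some_inj, ← this,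
        List.getElem_cons, dif_neg (by omega), ← List.getElem?_eq_getElem]
      congr 1
      simp
      omega
  have hemb : ∀ b, Embeds (pathOfFn (contractAt v S.length (.ofBool b)) (n - 2)) G := by
    intro b
    obtain ⟨l₁, l₂, hl⟩ := hST b
    refine h.embeds_of_isRotated (l₁ := l₁) (l₂ := l₂) (by omega) ?_
    rw [hcon]
    simpa using hl
  refine not_not.2 ⟨2, fun i => pathOfFn (contractAt v S.length (if i = 0 then .plus else .minus))
    (n - 2), by norm_num, fun i => ⟨isPath_pathOfFn _ _, ?_⟩,
    ⟨fun x => π (fold S.length (x 0).val (x 1).val : ℕ), fun {x x'} hx => ?_⟩, fun z => ?_⟩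
  · fin_cases i
    · exact hemb true
    · exact hemb false
  · exact h.adj_of_near (near_fold h1 h2 (hx 0) (hx 1))
  · obtain ⟨i, hi, rfl⟩ := h.exists_lt_eq z
    obtain ⟨x, y, hx, hy, hxy⟩ := exists_fold_eq (a := S.length) hi (by omega)
    exact ⟨![⟨x, by omega⟩, ⟨y, by omega⟩], by simp [hxy]⟩

/-! ### Almost symmetric cycles -/

/-- The arc of a non-symmetric edge. -/
def arc (π : ℤ → V) (w : ℤ → Letter) (i : ℤ) : V × V :=
  if (w i).allows true then (π i, π (i + 1)) else (π (i + 1), π i)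

theorem arc_spec (h : Wound G n π w) {i : ℤ} (hi : w i ≠ .star) :
    G.Adj (arc π w i).1 (arc π w i).2 ∧ ¬ G.Adj (arc π w i).2 (arc π w i).1 := by
  obtain ⟨b, hb⟩ := (w i).eq_star_or_ofBool.resolve_left hi
  unfold arc
  split_ifs with hw
  · simp only [h.adj_succ_iff, h.succ_adj_iff, hb, Letter.allows_ofBool] at hw ⊢
    simp [hw]
  · simp only [h.adj_succ_iff, h.succ_adj_iff, hb, Letter.allows_ofBool] at hw ⊢
    simpa using hw

theorem exists_arc_eq (h : Wound G n π w) {x y : V} (hxy : G.Adj x y) (hyx : ¬ G.Adj y x) :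
    ∃ i, w i ≠ .star ∧ (x, y) = arc π w i := by
  obtain ⟨i, rfl⟩ := h.surjective x
  obtain ⟨j, rfl⟩ := h.surjective y
  rcases (h.adj_iff i j).1 hxy with h1 | ⟨h1, h2⟩ | ⟨h1, h2⟩
  · rw [(h.eq_iff i j).2 h1] at hxy hyx
    exact absurd hxy hyx
  · have e : π j = π (i + 1) := by
      rw [eq_comm, h.eq_iff, ← sub_sub]
      exact h1
    refine ⟨i, fun hi => hyx ?_, by rw [arc, if_pos h2, e]⟩
    rw [e, h.succ_adj_iff, hi]
    rfl
  · have e : π i = π (j + 1) := by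
      rw [eq_comm, h.eq_iff, ← sub_sub]
      exact h1
    have hj : ¬ (w j).allows true = true := by rwa [e, h.adj_succ_iff] at hyx
    refine ⟨j, fun hi => hj ?_, by rw [arc, if_neg hj, e]⟩
    rw [hi]
    rfl

theorem eq_of_arc_eq (h : Wound G n π w) {i j : ℤ} (hij : arc π w i = arc π w j) : π i = π j := by
  -- Two edges with the same ends in opposite order would force `n` to divide 2.
  have key : ∀ {i j}, π i = π (j + 1) → π (i + 1) = π j → False := by
    intro i j h1 h2
    rw [h.eq_iff] at h1 h2
    have h3 := dvd_sub h1 h2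
    have := h.three_le
    have := Int.le_of_dvd (by omega) h3
    omega
  unfold arc at hij
  split_ifs at hij <;> rw [Prod.mk.injEq] at hij
  · exact hij.1
  · exact (key hij.1 hij.2).elim
  · exact (key hij.2 hij.1).elim
  · exact hij.2

theorem almostSymmetric_iff {G : Digraph (Fin n)} {π : ℤ → Fin n} (h : Wound G n π w) :
    AlmostSymmetric G ↔ ∃ c, ∀ i, w i ≠ .star ↔ (n : ℤ) ∣ c - i := by
  constructor
  · rintro ⟨⟨x, y⟩, ⟨h1, h2⟩, huniq⟩
    obtain ⟨c, hc, hxy⟩ := h.exists_arc_eq h1 h2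
    refine ⟨c, fun i => ⟨fun hi => ?_, fun hi => by rwa [h.eq_of_dvd hi]⟩⟩
    rw [← h.eq_iff]
    exact h.eq_of_arc_eq ((huniq _ (h.arc_spec hi)).trans hxy)
  · rintro ⟨c, hc⟩
    refine ⟨arc π w c, h.arc_spec ((hc c).2 (by simp)), ?_⟩
    rintro ⟨x, y⟩ ⟨h1, h2⟩
    obtain ⟨i, hi, hxy⟩ := h.exists_arc_eq h1 h2
    have hd := (hc i).1 hi
    rw [hxy, arc, arc, h.eq_of_dvd hd, (h.eq_iff i c).2 hd,
      (h.eq_iff (i + 1) (c + 1)).2 (by simpa using hd)]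

/-- Starting behind the non-symmetric edge, the word is `stars (m + 2)` followed by one letter `b`.
Contracting the first ** to either direction gives one non-symmetric letter followed by symmetric
ones, a factor in one of the two readings. -/
theorem not_pathCondition_of_almostSymmetric {G : Digraph (Fin n)} {π : ℤ → Fin n}
    (h : Wound G n π w) (hG : AlmostSymmetric G) : ¬ PathCondition G := by
  obtain ⟨c, hc⟩ := h.almostSymmetric_iff.1 hG
  obtain ⟨m, rfl⟩ : ∃ m, n = m + 3 := ⟨n - 3, by have := h.three_le; omega⟩
  obtain ⟨b, hb⟩ := (w c).eq_star_or_ofBool.resolve_left ((hc c).2 (by simp))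
  have hf : factor (fun i => w (c + 1 + i)) 0 (m + 3) = stars (m + 2) ++ [.ofBool b] := by
    rw [factor_succ' (k := m + 2), ← hb, ← h.periodic c]
    congr 1
    · refine List.eq_replicate_iff.2 ⟨by simp, fun l hl => ?_⟩
      obtain ⟨i, hi, rfl⟩ := List.getElem_of_mem hl
      rw [getElem_factor]
      simp at hi
      by_contra hne
      have := Int.le_of_dvd (by omega) ((dvd_neg).2 ((hc _).1 hne))
      omega
    · push_cast
      ring_nf
  have hst : stars (m + 2) = stars 2 ++ stars m := by
    rw [stars, stars, stars, List.replicate_append_replicate, add_comm]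
  refine (h.shift (c + 1)).not_pathCondition (S := []) (T := stars m) (y := .ofBool b) ?_ ?_
  · rw [hf, hst]
    rfl
  · intro b'
    refine ⟨.star, .star, ?_⟩
    have e : stars m ++ stars 2 = stars (m + 2) := List.replicate_append_replicate
    change stars m ++ [.star, .star] = _ at e
    rw [hf, e]
    have hbar : barWord (stars (m + 2)) = stars (m + 2) := by simp [barWord]
    by_cases hbb : b' = b
    · rw [hbb]
      exact Or.inl (List.isRotated_append (l := [_]))
    · right
      have : b' = !b := by cases b <;> cases b' <;> simp at hbb ⊢
      rw [barWord_append, hbar, barWord_singleton, Letter.bar_ofBool, this]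
      rfl

end Wound

/-! ### The special form -/

theorem barWord_powWord_append {U : List Letter} (hU : U = barWord U) (k : ℕ) :
    barWord (powWord (U ++ stars 2) k ++ U) = powWord (U ++ stars 2) k ++ U := by
  induction k with
  | zero => simpa [powWord] using hU.symm
  | succ k ih =>
    have : barWord (stars 2) = stars 2 := rfl
    conv_lhs => rw [powWord_succ, List.append_assoc, barWord_append, ih, barWord_append, ← hU, this]
    rw [powWord_succ']
    simp

theorem eq_factor_of_get {w : ℤ → Letter} {W : List Letter}
    (hw : ∀ i : Fin W.length, w i.val = W.get i) : W = factor w 0 W.length := by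
  refine List.ext_getElem (by simp) fun i h1 h2 => ?_
  rw [getElem_factor, zero_add]
  exact (hw ⟨i, h1⟩).symm

/-- The first ** is contracted. The result with + is a factor after a rotation; the one with - is a
factor of the reversed word, because (U**)^k U is self-dual. -/
theorem HasSpecialForm.not_pathCondition {n : ℕ} {G : Digraph (Fin n)} (hn : 3 ≤ n)
    (hG : IsCycle G) (h : HasSpecialForm G) : ¬ PathCondition G := by
  rcases h with h | ⟨s, S, k, -, hS, hk, ⟨e⟩⟩
  · obtain ⟨π, w, hw⟩ := hG.exists_wound hn
    exact hw.not_pathCondition_of_almostSymmetric h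
  · obtain rfl : n = (starWord S k).length := by simpa using Fintype.card_congr e.toEquiv
    obtain ⟨π, w, hw, hwV⟩ := wound_cycleOfWord hn
    obtain ⟨k, rfl⟩ : ∃ k', k = k' + 1 := ⟨k - 1, by omega⟩
    have hSU : pathWord S = barWord (pathWord S) := hS
    obtain ⟨U, hU⟩ : ∃ U, pathWord S = U := ⟨_, rfl⟩
    rw [hU] at hSU
    have hV : powWord (U ++ stars 2) (k + 1) ++ U ++ [Letter.ofBool true] =
        factor w 0 (starWord S (k + 1)).length := by
      rw [← eq_factor_of_get hwV, starWord, hU]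
      rfl
    have e1 : powWord (U ++ stars 2) (k + 1) ++ U =
        U ++ stars 2 ++ (powWord (U ++ stars 2) k ++ U) := by
      rw [powWord_succ, List.append_assoc]
    have e2 : powWord (U ++ stars 2) (k + 1) ++ U =
        powWord (U ++ stars 2) k ++ U ++ stars 2 ++ U := by
      rw [powWord_succ']
      simp
    refine (hw.map e.symm).not_pathCondition (S := U) (T := powWord (U ++ stars 2) k ++ U)
      (y := .ofBool true) (by rw [← e1]; exact hV) fun b => ⟨.star, .star, ?_⟩
    rw [← hV]
    cases b
    · right
      rw [barWord_append, barWord_powWord_append hSU, e2, barWord_singleton]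
      refine (List.isRotated_append (l := U)).trans ?_
      simp only [List.cons_append, List.append_assoc, List.nil_append]
      exact List.IsRotated.refl _
    · left
      rw [e2]
      have := List.isRotated_append (l := U ++ [.ofBool true])
        (l' := powWord (U ++ stars 2) k ++ U ++ stars 2)
      simp only [List.cons_append, List.append_assoc, List.nil_append] at this ⊢
      exact this

/-! ### Paths that embed in a cycle -/

namespace Wound

variable {V : Type*} {G : Digraph V} {n : ℕ} {π : ℤ → V} {w : ℤ → Letter}

theorem eq_or_eq_of_adj (h : Wound G n π w) {i : ℤ} {x : V}
    (hx : G.Adj (π i) x ∨ G.Adj x (π i)) : x = π i ∨ x = π (i + 1) ∨ x = π (i - 1) := by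
  obtain ⟨j, rfl⟩ := h.surjective x
  simp only [h.eq_iff]
  have e1 : i + 1 - j = -(j - i - 1) := by ring
  have e2 : i - 1 - j = i - j - 1 := by ring
  have e3 : i - j = -(j - i) := by ring
  rw [e1, e2, dvd_neg]
  rcases hx with hx | hx <;> rw [h.adj_iff] at hx <;> rcases hx with hx | hx | hx
  · exact Or.inl (by rwa [e3, dvd_neg])
  · exact Or.inr (Or.inl hx.1)
  · exact Or.inr (Or.inr hx.1)
  · exact Or.inl hx
  · exact Or.inr (Or.inr hx.1)
  · exact Or.inr (Or.inl hx.1)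

/-- An injective walk in a cycle can neither rest nor turn back, so its first step determines it. -/
theorem eq_of_injective (h : Wound G n π w) {k : ℕ} {p : ℕ → V}
    (hadj : ∀ j < k, G.Adj (p j) (p (j + 1)) ∨ G.Adj (p (j + 1)) (p j))
    (hinj : ∀ i j, i ≤ k → j ≤ k → p i = p j → i = j) {c : ℤ} (h0 : p 0 = π c)
    (h1 : 1 ≤ k → p 1 = π (c + 1)) : ∀ j ≤ k, p j = π (c + j) := by
  intro j
  induction j using Nat.strong_induction_on with
  | _ j ih =>
    intro hj
    match j, ih, hj with
    | 0, _, _ => simpa using h0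
    | 1, _, hj => simpa using h1 hj
    | j + 2, ih, hj =>
      have e1 := ih (j + 1) (by omega) (by omega)
      have e2 := ih j (by omega) (by omega)
      have h2 := hadj (j + 1) (by omega)
      rw [e1] at h2
      rcases h.eq_or_eq_of_adj h2 with h3 | h3 | h3
      · have := hinj (j + 2) (j + 1) hj (by omega) (h3.trans e1.symm)
        omega
      · rw [h3]
        push_cast
        ring_nf
      · have := hinj (j + 2) j hj (by omega) (by rw [h3, e2]; push_cast; ring_nf)
        omega

theorem exists_shift_of_injective (h : Wound G n π w) {k : ℕ} {p : ℕ → V}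
    (hadj : ∀ j < k, G.Adj (p j) (p (j + 1)) ∨ G.Adj (p (j + 1)) (p j))
    (hinj : ∀ i j, i ≤ k → j ≤ k → p i = p j → i = j) :
    ∃ c, (∀ j ≤ k, p j = π (c + j)) ∨ ∀ j ≤ k, p j = π (-(c + j)) := by
  obtain ⟨c, hc⟩ := h.surjective (p 0)
  by_cases hk : 1 ≤ k
  swap
  · exact ⟨c, Or.inl (h.eq_of_injective hadj hinj hc.symm fun h => absurd h hk)⟩
  have h1 := hadj 0 hk
  rw [← hc] at h1
  rcases h.eq_or_eq_of_adj h1 with h2 | h2 | h2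
  · have := hinj _ _ hk (Nat.zero_le _) (h2.trans hc)
    omega
  · exact ⟨c, Or.inl (h.eq_of_injective hadj hinj hc.symm fun _ => h2)⟩
  · refine ⟨-c, Or.inr (h.reflect.eq_of_injective hadj hinj (by simpa using hc.symm) fun _ => ?_)⟩
    rw [h2]
    ring_nf

theorem exists_letters_of_embeds (h : Wound G n π w) {k : ℕ} (hk : k + 2 ≤ n)
    {Q : Digraph (Fin (k + 1))} (hQ : IsPath Q) (hE : Embeds Q G) :
    ∃ u c, Q = pathOfFn u k ∧ ((List.range k).map u = factor w c k ∨
      (List.range k).map u = barWord (factor w c k)) := by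
  obtain ⟨φ⟩ := hE
  have hp : ∀ i (hi : i ≤ k), φ (Fin.ofNat (k + 1) i) = φ ⟨i, by omega⟩ := fun i hi => by
    congr 1
    exact Fin.ext (Nat.mod_eq_of_lt (by omega))
  obtain ⟨c, hc⟩ := h.exists_shift_of_injective (k := k) (p := fun i => φ (Fin.ofNat (k + 1) i))
    (fun j hj => by
      simp only [hp _ hj.le, hp (j + 1) hj, φ.map_rel_iff]
      exact hQ.consec ⟨j, hj⟩)
    (fun i j hi hj hij => by
      simp only [hp _ hi, hp _ hj] at hij
      exact Fin.ext_iff.1 (φ.injective hij))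
  have key : ∀ {π w}, Wound G n π w → (∀ j ≤ k, φ (Fin.ofNat (k + 1) j) = π (j : ℕ)) →
      Q = pathOfFn (fun i => w i) k := by
    intro π w h hφ
    ext i j
    change _ ↔ Near (fun i : ℕ => w i) i j
    rw [← h.adj_iff_near hk (fun _ _ => rfl) i.is_le j.is_le, ← hφ _ i.is_le, ← hφ _ j.is_le,
      hp _ i.is_le, hp _ j.is_le, φ.map_rel_iff]
  have e0 : ∀ (w : ℤ → Letter) c, (List.range k).map (fun i : ℕ => w (c + i)) = factor w c k :=
    fun _ _ => rfl
  rcases hc with hc | hc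
  · exact ⟨_, c, key (h.shift c) hc, Or.inl rfl⟩
  · refine ⟨_, -c - k, key (h.reflect.shift c) hc, Or.inr ?_⟩
    rw [barWord_factor, e0 (fun i => (w (-i - 1)).bar), show -(-c - (k : ℤ)) - k = c by ring]

end Wound

/-! ### Walks that follow a pattern -/

/-- There is a walk from `x` to `y` along arcs with the directions given by the pattern. -/
def Walk {α : Type*} (r : α → α → Prop) : List Bool → α → α → Prop
  | [], x, y => x = y
  | c :: p, x, y => ∃ z, (c = true → r x z) ∧ (c = false → r z x) ∧ Walk r p z y

theorem Walk.map {α β : Type*} {r : α → α → Prop} {s : β → β → Prop} {f : α → β}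
    (hf : ∀ x y, r x y → s (f x) (f y)) : ∀ {p : List Bool} {x y : α}, Walk r p x y →
    Walk s p (f x) (f y)
  | [], _, _, h => congrArg f h
  | _ :: _, _, _, ⟨z, h1, h2, h3⟩ =>
    ⟨f z, fun h => hf _ _ (h1 h), fun h => hf _ _ (h2 h), h3.map hf⟩

theorem walk_pi {ι : Type*} {α : ι → Type*} {r : ∀ i, α i → α i → Prop} :
    ∀ {p : List Bool} {x y : ∀ i, α i}, (∀ i, Walk (r i) p (x i) (y i)) →
      Walk (fun x y => ∀ i, r i (x i) (y i)) p x y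
  | [], _, _, h => funext h
  | _ :: _, _, _, h => by
    choose z h1 h2 h3 using h
    exact ⟨z, fun hc i => h1 i hc, fun hc i => h2 i hc, walk_pi h3⟩

theorem walk_of_sublist {α : Type*} {r : α → α → Prop} (hr : ∀ x, r x x) {s p : List Bool}
    (hs : s.Sublist p) {x y : α} (h : Walk r s x y) : Walk r p x y := by
  induction hs generalizing x with
  | slnil => exact h
  | cons c _ ih => exact ⟨x, fun _ => hr x, fun _ => hr x, ih h⟩
  | cons_cons c _ ih =>
    obtain ⟨z, h1, h2, h3⟩ := h
    exact ⟨z, h1, h2, ih h3⟩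

theorem walk_up {u : ℕ → Letter} {k a : ℕ} {p : List Bool}
    (h : Contains ((List.range' a k).map u) p) : Walk (Near u) p a (a + k) := by
  obtain ⟨s, hs, hW⟩ := h
  refine walk_of_sublist (r := Near u) (fun _ => Or.inl rfl) hs ?_
  clear hs p
  induction k generalizing a s with
  | zero =>
    cases hW
    rfl
  | succ k ih =>
    rw [List.range'_succ, List.map_cons] at hW
    obtain _ | ⟨hc, hW⟩ := hW
    refine ⟨a + 1, ?_, ?_, by
      rw [add_comm k, ← add_assoc]
      exact ih _ hW⟩
    · rintro rfl
      exact Or.inr (Or.inl ⟨rfl, hc⟩)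
    · rintro rfl
      exact Or.inr (Or.inr ⟨rfl, hc⟩)

theorem walk_down {u : ℕ → Letter} {k a : ℕ} {p : List Bool}
    (h : Contains (barWord ((List.range' a k).map u)) p) : Walk (Near u) p (a + k) a := by
  obtain ⟨s, hs, hW⟩ := h
  refine walk_of_sublist (r := Near u) (fun _ => Or.inl rfl) hs ?_
  clear hs p
  induction k generalizing s with
  | zero =>
    cases hW
    rfl
  | succ k ih =>
    rw [List.range'_concat, List.map_append, barWord_append] at hW
    obtain _ | ⟨hc, hW⟩ := hW
    simp only [one_mul, Letter.allows_bar] at hc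
    refine ⟨a + k, ?_, ?_, ih _ hW⟩
    · rintro rfl
      exact Or.inr (Or.inr ⟨rfl, hc⟩)
    · rintro rfl
      exact Or.inr (Or.inl ⟨rfl, hc⟩)

/-- Any segment of the path is an infix of its word, read upwards or downwards; the unused
directions of the pattern are spent on loops. -/
theorem walk_near {u : ℕ → Letter} {k : ℕ} {p : List Bool}
    (h1 : Contains ((List.range k).map u) p) (h2 : Contains (barWord ((List.range k).map u)) p)
    {x y : ℕ} (hx : x ≤ k) (hy : y ≤ k) : Walk (Near u) p x y := by
  have key : ∀ {x y}, x ≤ y → y ≤ k → (List.range k).map u =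
      (List.range' 0 x).map u ++ (List.range' x (y - x)).map u ++
        (List.range' y (k - y)).map u := by
    intro x y hx hy
    rw [List.range_eq_range', ← List.map_append, ← List.map_append]
    congr 1
    have e1 := List.range'_append_1 (s := 0) (m := x) (n := y - x)
    have e2 := List.range'_append_1 (s := 0) (m := y) (n := k - y)
    rw [zero_add] at e1 e2
    rw [e1, Nat.add_sub_cancel' hx, e2, Nat.add_sub_cancel' hy]
  rcases le_total x y with hxy | hxy
  · rw [key hxy hy] at h1
    have := walk_up (Contains.infix h1)
    rwa [Nat.add_sub_cancel' hxy] at this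
  · rw [key hxy hx, barWord_append, barWord_append, ← List.append_assoc] at h2
    have := walk_down (Contains.infix h2)
    rwa [Nat.add_sub_cancel' hxy] at this

/-- There is an arc from `i` to `j` in the two-way infinite path with the letters `w`. -/
def IntNear (w : ℤ → Letter) (i j : ℤ) : Prop :=
  i = j ∨ (j = i + 1 ∧ (w i).allows true = true) ∨ (i = j + 1 ∧ (w j).allows false = true)

/-- Steps have length at most 1, so the walk crosses the edges of the factor; the first crossings of
successive edges occur in order and match its letters. -/
theorem contains_factor_of_walk {w : ℤ → Letter} {p : List Bool} {s t m : ℤ} {k : ℕ}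
    (h : Walk (IntNear w) p s t) (hs : s ≤ m) (ht : m + k ≤ t) : Contains (factor w m k) p := by
  induction p generalizing s m k with
  | nil =>
    obtain rfl : k = 0 := by
      have : s = t := h
      omega
    exact Contains.nil _
  | cons c p ih =>
    obtain ⟨z, h1, h2, h3⟩ := h
    cases k with
    | zero => exact Contains.nil _
    | succ k =>
      by_cases hz : z ≤ m
      · exact (ih h3 hz ht).mono (List.sublist_cons_self _ _)
      have ih' := ih (m := m + 1) (k := k) h3 (by
        cases c
        · rcases h2 rfl with h | h | h <;> omega
        · rcases h1 rfl with h | h | h <;> omega) (by push_cast at ht; omega)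
      rw [factor_succ]
      refine Contains.cons ?_ ih'
      cases c
      · rcases h2 rfl with h | h | h
        · omega
        · obtain rfl : s = m := by omega
          omega
        · obtain rfl : s = m := by omega
          exact h.2
      · rcases h1 rfl with h | h | h
        · omega
        · obtain rfl : s = m := by omega
          exact h.2
        · omega

/-! ### Lifting homomorphisms to a cycle -/

open Classical in
/-- The signed distance from `x` to `y` along the cycle, for adjacent vertices. -/
noncomputable def delta {V : Type*} (π : ℤ → V) (x y : V) : ℤ :=
  if h : ∃ d : ℤ, |d| ≤ 1 ∧ ∃ i, π i = x ∧ π (i + d) = y then h.choose else 0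

/-- Every homomorphism to the cycle `G` lifts to the unrolled cycle. -/
def Liftable {α V : Type*} (G : Digraph V) (π : ℤ → V) (R : α → α → Prop) : Prop :=
  ∀ f : α → V, (∀ x y, R x y → G.Adj (f x) (f y)) →
    ∃ F : α → ℤ, (∀ x, π (F x) = f x) ∧ ∀ x y, R x y → F y - F x = delta π (f x) (f y)

namespace Wound

variable {V : Type*} {G : Digraph V} {n : ℕ} {π : ℤ → V} {w : ℤ → Letter}

theorem delta_eq (h : Wound G n π w) {i d : ℤ} (hd : |d| ≤ 1) :
    delta π (π i) (π (i + d)) = d := by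
  have hex : ∃ d' : ℤ, |d'| ≤ 1 ∧ ∃ j, π j = π i ∧ π (j + d') = π (i + d) := ⟨d, hd, i, rfl, rfl⟩
  rw [delta, dif_pos hex]
  obtain ⟨h1, j, h2, h3⟩ := hex.choose_spec
  rw [h.eq_iff] at h2 h3
  have := h.three_le
  rw [abs_le] at h1 hd
  have h4 := dvd_sub h3 h2
  rw [dvd_iff_eq_zero (abs_lt.2 ⟨by linarith, by linarith⟩)] at h4
  linarith

theorem exists_step (h : Wound G n π w) {x y : V} (hxy : G.Adj x y ∨ G.Adj y x) {i : ℤ}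
    (hi : π i = x) : |delta π x y| ≤ 1 ∧ π (i + delta π x y) = y := by
  subst hi
  obtain ⟨d, hd, rfl⟩ : ∃ d : ℤ, |d| ≤ 1 ∧ y = π (i + d) := by
    rcases h.eq_or_eq_of_adj hxy with h | h | h
    · exact ⟨0, by simp, by simpa using h⟩
    · exact ⟨1, by simp, h⟩
    · exact ⟨-1, by simp, h⟩
  rw [h.delta_eq hd]
  exact ⟨hd, rfl⟩

theorem delta_comm (h : Wound G n π w) {x y : V} (hxy : G.Adj x y) :
    delta π y x = -delta π x y := by
  obtain ⟨i, rfl⟩ := h.surjective x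
  obtain ⟨h1, h2⟩ := h.exists_step (Or.inl hxy) rfl
  have := h.delta_eq (i := i + delta π (π i) y) (d := -delta π (π i) y) (by rwa [abs_neg])
  rwa [add_neg_cancel_right, h2] at this

/-- The defect is a multiple of `n` of absolute value at most 3. This is where `n ≥ 4` is needed: a
3-cycle may be a triangle that does not lift. -/
theorem delta_add (h : Wound G n π w) (hn : 4 ≤ n) {x y z : V} (hxy : G.Adj x y ∨ G.Adj y x)
    (hyz : G.Adj y z ∨ G.Adj z y) (hxz : G.Adj x z ∨ G.Adj z x) :
    delta π x y + delta π y z = delta π x z := by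
  obtain ⟨i, hi⟩ := h.surjective x
  obtain ⟨h1, h2⟩ := h.exists_step hxy hi
  obtain ⟨h3, h4⟩ := h.exists_step hyz h2
  obtain ⟨h5, h6⟩ := h.exists_step hxz hi
  have h7 := h4.trans h6.symm
  rw [abs_le] at h1 h3 h5
  rw [h.eq_iff, dvd_iff_eq_zero (abs_lt.2 ⟨by linarith, by linarith⟩)] at h7
  linarith

/-- The lift on the slice `t = 0` is extended along the second coordinate by summing the signed
steps. Compatibility passes from slice to slice, since each square over an arc has a diagonal arc
and splits into two triangles. -/
theorem liftable_prod (h : Wound G n π w) (hn : 4 ≤ n) {α : Type*} {R : α → α → Prop}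
    (hR : ∀ x, R x x) (hL : Liftable G π R) (u : ℕ → Letter) :
    Liftable G π fun p q : α × ℕ => R p.1 q.1 ∧ Near u p.2 q.2 := by
  intro f hf
  obtain ⟨F₀, h0, hF₀⟩ := hL (fun x => f (x, 0)) fun x y hxy => hf _ _ ⟨hxy, Or.inl rfl⟩
  let F : α → ℕ → ℤ := fun x t =>
    F₀ x + ∑ s ∈ Finset.range t, delta π (f (x, s)) (f (x, s + 1))
  have hF : ∀ x t, F x (t + 1) = F x t + delta π (f (x, t)) (f (x, t + 1)) := fun x t => by
    simp only [F, Finset.sum_range_succ, add_assoc]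
  have hadj : ∀ {x y t}, R x y → G.Adj (f (x, t)) (f (y, t)) := fun hxy =>
    hf _ _ ⟨hxy, Or.inl rfl⟩
  have hdir : ∀ t, (∀ {x y}, R x y → G.Adj (f (x, t)) (f (y, t + 1))) ∨
      ∀ {x y}, R x y → G.Adj (f (x, t + 1)) (f (y, t)) := by
    intro t
    by_cases hu : (u t).allows true = true
    · exact Or.inl fun hxy => hf _ _ ⟨hxy, Or.inr (Or.inl ⟨rfl, hu⟩)⟩
    · refine Or.inr fun hxy => hf _ _ ⟨hxy, Or.inr (Or.inr ⟨rfl, ?_⟩)⟩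
      generalize u t = l at hu
      cases l <;> simp [Letter.allows] at hu ⊢
  have hstep : ∀ x t, G.Adj (f (x, t)) (f (x, t + 1)) ∨ G.Adj (f (x, t + 1)) (f (x, t)) :=
    fun x t => (hdir t).imp (fun h => h (hR x)) fun h => h (hR x)
  have hlift : ∀ x t, π (F x t) = f (x, t) := by
    intro x t
    induction t with
    | zero => simp [F, h0]
    | succ t ih =>
      rw [hF]
      exact (h.exists_step (hstep x t) ih).2
  have hcomm : ∀ {x y}, G.Adj x y ∨ G.Adj y x → delta π y x = -delta π x y := by
    rintro x y (hxy | hxy)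
    · exact h.delta_comm hxy
    · rw [h.delta_comm hxy, neg_neg]
  have hdiff : ∀ t x y, R x y → F y t - F x t = delta π (f (x, t)) (f (y, t)) := by
    intro t
    induction t with
    | zero =>
      intro x y hxy
      simpa [F] using hF₀ x y hxy
    | succ t ih =>
      intro x y hxy
      have e1 := ih x y hxy
      rw [hF, hF]
      -- The diagonal of the square joins `(x, t)` to `(y, t + 1)` or `(x, t + 1)` to `(y, t)`,
      -- according to the letter `u t`.
      rcases hdir t with hd | hd
      · have e2 := h.delta_add hn (Or.inl (hadj hxy)) (hstep y t) (Or.inl (hd hxy))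
        have e3 := h.delta_add hn (hstep x t) (Or.inl (hadj hxy)) (Or.inl (hd hxy))
        linarith
      · have e2 := h.delta_add hn (hstep x t).symm (Or.inl (hadj hxy)) (Or.inl (hd hxy))
        have e3 := h.delta_add hn (Or.inl (hadj hxy)) (hstep y t).symm (Or.inl (hd hxy))
        have e4 := hcomm (hstep x t)
        have e5 := hcomm (hstep y t)
        linarith
  refine ⟨fun p => F p.1 p.2, fun p => hlift _ _, ?_⟩
  rintro ⟨x, s⟩ ⟨y, t⟩ ⟨hxy, hst⟩
  have hA := hf (x, s) (y, t) ⟨hxy, hst⟩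
  rcases hst with hst | ⟨hst, -⟩ | ⟨hst, -⟩ <;> simp only at hst hxy ⊢ <;> subst hst
  · exact hdiff _ _ _ hxy
  · rw [hF, ← h.delta_add hn (Or.inl (hadj hxy)) (hstep y s) (Or.inl hA), ← hdiff _ _ _ hxy]
    ring
  · rw [hF, ← h.delta_add hn (hstep x t).symm (Or.inl (hadj hxy)) (Or.inl hA), ← hdiff _ _ _ hxy,
      hcomm (hstep x t)]
    ring

theorem liftable_pi (h : Wound G n π w) (hn : 4 ≤ n) : ∀ {m : ℕ} (u : Fin m → ℕ → Letter),
    Liftable G π fun x y : Fin m → ℕ => ∀ i, Near (u i) (x i) (y i)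
  | 0, u => by
    intro f hf
    obtain ⟨i, hi⟩ := h.surjective (f 0)
    have hx : ∀ x, f x = f 0 := fun x => congrArg f (Subsingleton.elim _ _)
    refine ⟨fun _ => i, fun x => by rw [hx, hi], fun x y _ => ?_⟩
    have := h.delta_eq (i := i) (d := 0) (by simp)
    rw [add_zero, hi] at this
    rw [hx x, hx y, this, sub_self]
  | m + 1, u => by
    intro f hf
    obtain ⟨F, h1, h2⟩ := h.liftable_prod hn (fun x i => Or.inl rfl)
      (h.liftable_pi hn fun i => u i.succ) (u 0) (fun p => f (Fin.cons p.2 p.1)) fun p q hpq =>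
        hf _ _ (Fin.forall_fin_succ.2 (by simpa using hpq.symm))
    refine ⟨fun x => F (Fin.tail x, x 0), fun x => ?_, fun x y hxy => ?_⟩
    · rw [h1, Fin.cons_self_tail]
    · rw [h2 _ _ ⟨fun i => hxy i.succ, hxy 0⟩]
      simp only [Fin.cons_self_tail]

/-- Let `F x` be the least value. The residue class of `F x + (n - 1)` is attained, and its smallest
member that is not below `F x` is `F x + (n - 1)` itself. -/
theorem exists_far (h : Wound G n π w) {α : Type*} [Nonempty α] {F : α → ℤ}
    (hF : Function.Surjective fun x => π (F x)) : ∃ x y, F x + (n - 1) ≤ F y := by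
  by_contra! hc
  obtain ⟨x₀⟩ := ‹Nonempty α›
  obtain ⟨_, ⟨x, rfl⟩, hm⟩ := Int.exists_least_of_bdd (P := fun z => ∃ x, F x = z)
    ⟨F x₀ - (n - 1), by
      rintro _ ⟨x, rfl⟩
      linarith [hc x x₀]⟩ ⟨_, x₀, rfl⟩
  obtain ⟨y, hy⟩ := hF (π (F x + (n - 1)))
  rw [h.eq_iff] at hy
  have h1 := hm _ ⟨y, rfl⟩
  have h2 := hc x y
  have := Int.eq_zero_of_abs_lt_dvd hy (abs_lt.2 ⟨by linarith, by linarith⟩)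
  linarith

theorem intNear_of_lift (h : Wound G n π w) {x y : V} (hxy : G.Adj x y) {i j : ℤ} (hi : π i = x)
    (hj : π j = y) (hij : j - i = delta π x y) : IntNear w i j := by
  have h1 := (h.exists_step (Or.inl hxy) hi).1
  rw [← hij, abs_le] at h1
  subst hi hj
  obtain h2 | h2 | h2 : j = i ∨ j = i + 1 ∨ i = j + 1 := by omega
  · exact Or.inl h2.symm
  · subst h2
    exact Or.inr (Or.inl ⟨rfl, (h.adj_succ_iff i).1 hxy⟩)
  · subst h2
    exact Or.inr (Or.inr ⟨rfl, (h.succ_adj_iff j).1 hxy⟩)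

theorem exists_contains_factor {G : Digraph (Fin n)} {π : ℤ → Fin n} (h : Wound G n π w)
    (hn : 4 ≤ n) (hG : ¬ PathCondition G) : ∃ c, ∀ p,
    (∀ c', Contains (factor w c' (n - 2)) p ∧ Contains (barWord (factor w c' (n - 2))) p) →
      Contains (factor w c (n - 1)) p := by
  obtain ⟨m, Q, -, hQ, f, hf⟩ := not_not.1 hG
  choose u c hu hc using fun i =>
    h.exists_letters_of_embeds (k := n - 2) (by omega) (hQ i).1 (hQ i).2
  -- Clamping coordinates at `n - 2` retracts the product of infinite paths onto the product of the
  -- `Q i`, so that lifting is only needed for infinite paths.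
  let κ : (Fin m → ℕ) → ∀ _ : Fin m, Fin (n - 2 + 1) := fun x i => ⟨min (x i) (n - 2), by omega⟩
  have hκ : ∀ x y : Fin m → ℕ, (∀ i, Near (u i) (x i) (y i)) →
      (prodDigraph Q).Adj (κ x) (κ y) := by
    intro x y hxy i
    rw [hu i]
    change Near (u i) (min (x i) (n - 2)) (min (y i) (n - 2))
    rcases hxy i with h | ⟨h, h'⟩ | ⟨h, h'⟩
    · exact Or.inl (by omega)
    · by_cases hx : x i < n - 2
      · exact Or.inr (Or.inl ⟨by omega, by rwa [min_eq_left hx.le]⟩)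
      · exact Or.inl (by omega)
    · by_cases hx : y i < n - 2
      · exact Or.inr (Or.inr ⟨by omega, by rwa [min_eq_left hx.le]⟩)
      · exact Or.inl (by omega)
  obtain ⟨F, h1, h2⟩ := h.liftable_pi hn u (fun x => f (κ x)) fun x y hxy =>
    f.map_rel (hκ x y hxy)
  have hκs : ∀ x, κ (fun i => (x i).val) = x := fun x =>
    funext fun i => Fin.ext (min_eq_left (x i).is_le)
  have hFs : Function.Surjective fun x : ∀ _ : Fin m, Fin (n - 2 + 1) =>
      π (F fun i => (x i).val) := by
    intro z
    obtain ⟨x, rfl⟩ := hf z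
    exact ⟨x, by simp only [h1, hκs]⟩
  obtain ⟨x, y, hxy⟩ := h.exists_far hFs
  refine ⟨F fun i => (x i).val, fun p hp => ?_⟩
  have hwalk : ∀ i, Walk (Near (u i)) p (x i).val (y i).val := by
    intro i
    have hp' := hp (c i)
    refine walk_near ?_ ?_ (x i).is_le (y i).is_le
    · rcases hc i with h | h <;> rw [h]
      · exact hp'.1
      · exact hp'.2
    · rcases hc i with h | h <;> rw [h]
      · exact hp'.2
      · rw [barWord_barWord]
        exact hp'.1
  refine contains_factor_of_walk ((walk_pi hwalk).map (s := IntNear w) (f := F) fun x y hxy => ?_)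
    le_rfl (by rw [Nat.cast_sub (by omega)]; exact_mod_cast hxy)
  exact h.intNear_of_lift (f.map_rel (hκ x y hxy)) (h1 x) (h1 y) (h2 x y hxy)

end Wound

/-! ### Cycles that fail the path condition -/

theorem exists_stars_append_of_length_dirs : ∀ {W : List Letter}, (dirs W).length = 1 →
    ∃ a b d, W = stars a ++ .ofBool b :: stars d
  | [], h => by simp at h
  | l :: W, h => by
    rcases l.eq_star_or_ofBool with rfl | ⟨b, rfl⟩
    · rw [dirs_star_cons] at h
      obtain ⟨a, b, d, rfl⟩ := exists_stars_append_of_length_dirs h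
      exact ⟨a + 1, b, d, rfl⟩
    · simp only [dirs_ofBool_cons, List.length_cons, Nat.add_eq_right,
        List.length_eq_zero_iff] at h
      exact ⟨0, b, W.length, by rw [← eq_stars_of_dirs_eq_nil h]; rfl⟩

namespace Wound

variable {n : ℕ} {G : Digraph (Fin n)} {π : ℤ → Fin n} {w : ℤ → Letter}

theorem almostSymmetric_of_length_dirs (h : Wound G n π w) {c : ℤ}
    (hd : (dirs (factor w c n)).length = 1) : AlmostSymmetric G := by
  obtain ⟨a, b, d, hW⟩ := exists_stars_append_of_length_dirs hd
  have hlen := congrArg List.length hW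
  simp at hlen
  refine h.almostSymmetric_iff.2 ⟨c + a, fun i => ?_⟩
  obtain ⟨j, hj, hij⟩ := (h.shift c).exists_lt_eq (π i)
  rw [h.eq_iff] at hij
  have hwj : some (w i) = (stars a ++ .ofBool b :: stars d)[j]? := by
    rw [← hW, getElem?_factor _ _ hj, h.eq_of_dvd hij]
  have hdvd : (n : ℤ) ∣ c + a - i ↔ a = j := by
    rw [← dvd_add_left hij, dvd_iff_eq_zero (abs_lt.2 ⟨by omega, by omega⟩)]
    omega
  rw [hdvd]
  rcases lt_trichotomy j a with hja | rfl | hja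
  · rw [List.getElem?_append_left (by simpa using hja)] at hwj
    simp [hja] at hwj
    simp [hwj, hja.ne']
  · simp at hwj
    simp [hwj]
  · obtain ⟨e, rfl⟩ : ∃ e, j = a + 1 + e := ⟨j - (a + 1), by omega⟩
    rw [List.getElem?_append_right (by simp; omega), List.length_replicate,
      show a + 1 + e - a = e + 1 by omega, List.getElem?_cons_succ, List.getElem?_replicate,
      if_pos (by omega), Option.some_inj] at hwj
    simp [hwj]
    omega

theorem isomorphic_cycleOfWord (h : Wound G n π w) {W : List Letter} {c : ℤ}
    (hW : W ~r factor w c n) : Isomorphic G (cycleOfWord W) := by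
  obtain ⟨c', hc⟩ := eq_factor_of_isRotated h.periodic hW
  obtain rfl : n = W.length := by rw [hc, length_factor]
  obtain ⟨π', w', h', hw'⟩ := wound_cycleOfWord h.three_le
  have hf := eq_factor_of_get hw'
  have e : (fun i => w (c' + i)) = w' := (h.shift c').ext_letters h'.periodic fun i hi => by
    have h1 := getElem?_factor w' 0 hi
    rw [← hf, zero_add] at h1
    rw [← Option.some_inj, ← h1, ← getElem?_factor w c' hi, ← hc]
  exact (e ▸ h.shift c').isomorphic h'

theorem hasSpecialForm (h : Wound G n π w) (hn : 4 ≤ n) (hG : ¬ PathCondition G) :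
    HasSpecialForm G := by
  obtain ⟨c, hc⟩ := h.exists_contains_factor hn hG
  obtain ⟨m, rfl⟩ : ∃ m, n = m + 2 := ⟨n - 2, by omega⟩
  simp only [Nat.add_sub_cancel, show m + 2 - 1 = m + 1 from rfl] at hc
  have hsplit := factor_succ' w c (m + 1)
  have hrot : ∀ c', factor w c' m ++ [w (c' + m), w (c' + m + 1)] ~r factor w c (m + 2) := by
    intro c'
    rw [← factor_zero w (c' + m + 1 + 1), ← factor_succ, ← factor_succ, ← factor_add]
    exact isRotated_factor h.periodic _ _
  rcases word_form_of_contains (R := factor w c (m + 1)) (y := w (c + (m + 1 : ℕ)))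
    (by simp [factor_succ]) (fun p hp => hc p fun c' => hp _ _ _ (hsplit ▸ hrot c'))
    with hd | ⟨b, U, k, hb, hk, hU, hR⟩
  · rw [← hsplit] at hd
    exact Or.inl (h.almostSymmetric_of_length_dirs hd)
  · let S := pathOfFn (fun i => U.getD i .star) U.length
    have hS : pathWord S = U := by
      rw [pathWord_pathOfFn]
      refine List.ext_getElem (by simp) fun i h1 h2 => ?_
      simp [h2]
    refine Or.inr ⟨U.length, S, k, isPath_pathOfFn _ _, by rw [SelfDual, hS]; exact hU, hk, ?_⟩
    have hV : starWord S k = factor w c (m + 1) ++ [.ofBool true] := by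
      rw [starWord, hS, hR]
      rfl
    have hf : factor w c (m + 2) = factor w c (m + 1) ++ [.ofBool b] := by rw [hsplit, hb]
    -- The special form ends in +, so if the last letter is -, the cycle is read backwards; the rest
    -- of the word is self-dual.
    cases b
    · refine h.reflect.isomorphic_cycleOfWord (c := -c - (m + 2 : ℕ)) ?_
      rw [← barWord_factor, hf, barWord_append, hV, hR, barWord_powWord_append hU]
      exact List.isRotated_append
    · refine h.isomorphic_cycleOfWord (c := c) ?_
      rw [hf, hV]

end Wound

end CycleWords


theorem theorem4p2 (n : ℕ) (hn : 3 ≤ n) (G : Digraph (Fin n)) (hG : CycleWords.IsCycle G) :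
    (4 ≤ n → (¬ CycleWords.PathCondition G ↔ CycleWords.HasSpecialForm G)) ∧
      (CycleWords.HasSpecialForm G → ¬ CycleWords.PathCondition G) := by
  have hif : CycleWords.HasSpecialForm G → ¬ CycleWords.PathCondition G :=
    fun h => h.not_pathCondition hn hG
  obtain ⟨π, w, hw⟩ := hG.exists_wound hn
  exact ⟨fun h4 => ⟨hw.hasSpecialForm h4, hif⟩, hif⟩
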